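/- Model. Base stations (BSs) form a homogeneous Poisson point process (HPPP) of density $\lambda_B>0$ in $\mathbb R^2$. A typical device at the origin transmits its message $N\ge 1$ times, with power $P_{IoT}>0$ and signal bandwidth $b>0$, in one of the channels of $M\ge 1$ multiplexing bands of bandwidth $B>0$ each; every BS listens to all $M$ bands (benchmark protocol). IoT devices form an HPPP of density $\lambda_{IoT}\ge 0$ and incumbent transmitters, of power $P_I>0$ and bandwidth $B_I>0$, form an HPPP of density $\lambda_I\ge 0$. For each transmission $i\in\{1,\dots,N\}$, the interfering IoT devices $\tilde\Phi_{IoT,i}$ are obtained from the IoT devices by independent thinning with retention probability $N\beta_T\lambda_T\cdot\frac{\beta_F b}{MB}$ (a probability, hence assumed to be at most $1$), where $\lambda_T=t/T$, $t>0$ is the duration of a single message, $T>0$ the period between two messages, and $\beta_T,\beta_F\in[1,2]$ describe the degree of synchronization in time and frequency; the interfering incumbents $\tilde\Phi_{I,i}$ are obtained from the incumbents by independent thinning with retention probability $\min\{1,\frac{B_I}{MB}\}$. Put $$\tilde\lambda_{IoT}=N\beta_T\lambda_T\frac{\beta_F b}{MB}\lambda_{IoT},\qquad \tilde\lambda_I=\min\Big\{1,\frac{B_I}{MB}\Big\}\lambda_I,\qquad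 \hat P_I=\frac{P_I\, b/B_I}{P_{IoT}}.$$ All channels have independent fading power gains that are exponential with mean $1$, and the path loss exponent is $\alpha>2$. Under random repetition, different transmissions meet independent sets of interferers: the process of BSs, the fading gains $h_{i,j}$ from the typical device to the $j$-th BS in transmission $i$, and the sets $\tilde\Phi_{IoT,i}$, $\tilde\Phi_{I,i}$ ($1\le i\le N$), each taken with its fading gains, are mutually independent. For normalized noise power $\hat P_N\ge 0$, the signal-to-interference-plus-noise ratio of transmission $i$ at the $j$-th BS is $$\mathrm{SINR}_{i,j}=\frac{h_{i,j}\,x_j^{-\alpha}}{\hat P_N+\sum_{u\in\tilde\Phi_{IoT,i}}f_{u,j}\,y_{u,j}^{-\alpha}+\sum_{k\in\tilde\Phi_{I,i}}\hat P_I f_{k,j}\,y_{k,j}^{-\alpha}},$$ where $x_j$ is the distance from the origin to the $j$-th BS, $y_{u,j},y_{k,j}$ are the distances from the interferers to the $j$-th BS, and $f_{u,j},f_{k,j}$ are the fading gains of the interferers (a positive number divided by $0$ is $\infty$). With nearest BS association, the success probability $\bar{\mathbb P}_s^{B,R}(\hat P_N)$ is the probability that, for the BS $j$ nearest to the origin,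 $\mathrm{SINR}_{i,j}>\tau$ for at least one $i\in\{1,\dots,N\}$, where $\tau>0$. Theorem. In an interference-limited network, that is, both for $\hat P_N=0$ and in the limit $\hat P_N\to 0^+$, the success probability of the benchmark protocol under nearest BS association and random repetition is $$\bar{\mathbb P}_s^{B,R}=1-\sum_{k=0}^N\binom Nk(-1)^k\left(1+k\,\xi^{-1}\tau^{\delta}\,\frac{\tilde\lambda_{IoT}+\hat P_I^{\delta}\tilde\lambda_I}{\lambda_B}\right)^{-1},\qquad \delta=\frac2\alpha,\quad \xi=\frac{\sin(\pi\delta)}{\pi\delta}.$$ -/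

import Mathlib

open MeasureTheory ProbabilityTheory Filter Topology
open scoped ENNReal NNReal

namespace UNB

/-- The plane with its Euclidean norm and Lebesgue measure. -/
abbrev Plane : Type := EuclideanSpace ℝ (Fin 2)

section PointProcess

variable {Ω ι κ : Type*} [MeasurableSpace Ω]

/-- Number of points in `A` of the point process whose points are enumerated by `X`. -/
noncomputable def pointCount (X : ι → Ω → Plane) (A : Set Plane) (ω : Ω) : ℕ∞ :=
  {u | X u ω ∈ A}.encard

/-- `X` enumerates the points of a homogeneous Poisson point process of density `lam`: the number
of points in a bounded Borel set is Poisson distributed with mean `lam` times its area, and the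
numbers of points in disjoint bounded Borel sets are independent. (If `lam > 0` there are infinitely
many points; the density `0` corresponds to an empty index type.) -/
structure IsHPPP (P : Measure Ω) (X : ι → Ω → Plane) (lam : ℝ) : Prop where
  measurable_point : ∀ u, Measurable (X u)
  poisson_count : ∀ A : Set Plane, MeasurableSet A → Bornology.IsBounded A → ∀ k : ℕ,
    P {ω | pointCount X A ω = k} = poissonMeasure (lam * (volume A).toReal).toNNReal {k}
  indep_count : ∀ (n : ℕ) (A : Fin n → Set Plane), (∀ m, MeasurableSet (A m)) →
    (∀ m, Bornology.IsBounded (A m)) → Pairwise (fun m m' => Disjoint (A m) (A m')) →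
    iIndepFun (fun m => pointCount X (A m)) P

/-- The basic random elements attached to a population of transmitters: all the locations, the
retention of the transmitter `u`, the fading from the transmitter `u` to the receiver `j`. -/
inductive MarkSource (ι κ : Type*) where
  | locations : MarkSource ι κ
  | retained (u : ι) : MarkSource ι κ
  | fading (u : ι) (j : κ) : MarkSource ι κ

/-- The sigma-algebras generated by these random elements. -/
@[reducible] def markSigma (X : ι → Ω → Plane) (act : ι → Set Ω) (f : ι → κ → Ω → ℝ) :
    MarkSource ι κ → MeasurableSpace Ω
  | .locations => MeasurableSpace.comap (fun ω u => X u ω) inferInstance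
  | .retained u => MeasurableSpace.generateFrom {act u}
  | .fading u j => MeasurableSpace.comap (f u j) inferInstance

/-- The transmitters `X` form a homogeneous Poisson point process of density `lam`, each of them
is retained (event `act u`) with probability `p`, the fading power gain `f u j` from `u` to the
receiver `j` is exponential with mean `1`, and all the retentions and all the fading gains are
independent of each other and of the locations. -/
structure IsThinnedFadedHPPP (P : Measure Ω) (X : ι → Ω → Plane) (act : ι → Set Ω)
    (f : ι → κ → Ω → ℝ) (lam p : ℝ) : Prop where
  hppp : IsHPPP P X lam
  measurableSet_act : ∀ u, MeasurableSet (act u)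
  prob_act : ∀ u, P (act u) = ENNReal.ofReal p
  measurable_fading : ∀ u j, Measurable (f u j)
  law_fading : ∀ u j, P.map (f u j) = expMeasure 1
  indep : iIndep (markSigma X act f) P

open Classical in
/-- The thinned process: the random counting measure of the retained transmitters, each recorded
with its location and its fading gains to all the receivers. -/
noncomputable def thinned (X : ι → Ω → Plane) (act : ι → Set Ω) (f : ι → κ → Ω → ℝ) (ω : Ω) :
    Measure (Plane × (κ → ℝ)) :=
  Measure.sum fun u => if ω ∈ act u then Measure.dirac (X u ω, fun j => f u j ω) else 0

/-- Path loss `y ^ (-α)` over the distance `y` between `x` and `x'` (infinite at distance `0`). -/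
noncomputable def pathLoss (α : ℝ) (x x' : Plane) : ℝ≥0∞ :=
  ENNReal.ofReal (dist x x') ^ (-α)

/-- Interference at a receiver `j` located at `z`: the sum, over the retained transmitters, of
fading gain times path loss. -/
noncomputable def interference (α : ℝ) (X : ι → Ω → Plane) (act : ι → Set Ω)
    (f : ι → κ → Ω → ℝ) (j : κ) (z : Plane) (ω : Ω) : ℝ≥0∞ :=
  ∑' u, (act u).indicator (fun ω => ENNReal.ofReal (f u j ω) * pathLoss α (X u ω) z) ω

end PointProcess

/-- The parameters of the network. -/
structure Params where
  /-- number of transmissions of each message -/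
  N : ℕ
  /-- number of multiplexing bands -/
  M : ℕ
  /-- path loss exponent -/
  α : ℝ
  /-- decoding threshold -/
  τ : ℝ
  /-- density of the base stations -/
  lamB : ℝ
  /-- density of the IoT devices -/
  lamIoT : ℝ
  /-- density of the incumbent transmitters -/
  lamI : ℝ
  /-- transmit power of an IoT device -/
  PIoT : ℝ
  /-- transmit power of an incumbent -/
  PI : ℝ
  /-- bandwidth of an IoT signal -/
  b : ℝ
  /-- bandwidth of one multiplexing band -/
  B : ℝ
  /-- bandwidth of an incumbent signal -/
  BI : ℝ
  /-- duration of a single message -/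
  t : ℝ
  /-- period between two messages -/
  T : ℝ
  /-- time access parameter: `1` is slotted, `2` is unslotted -/
  betaT : ℝ
  /-- frequency access parameter: `1` is slotted, `2` is unslotted -/
  betaF : ℝ
  one_le_N : 1 ≤ N
  one_le_M : 1 ≤ M
  two_lt_α : 2 < α
  τ_pos : 0 < τ
  lamB_pos : 0 < lamB
  lamIoT_nonneg : 0 ≤ lamIoT
  lamI_nonneg : 0 ≤ lamI
  PIoT_pos : 0 < PIoT
  PI_pos : 0 < PI
  b_pos : 0 < b
  B_pos : 0 < B
  BI_pos : 0 < BI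
  t_pos : 0 < t
  T_pos : 0 < T
  betaT_mem : betaT ∈ Set.Icc (1 : ℝ) 2
  betaF_mem : betaF ∈ Set.Icc (1 : ℝ) 2

namespace Params

variable (p : Params)

/-- Temporal traffic generation. -/
noncomputable def lamT : ℝ := p.t / p.T

/-- Probability that an IoT device interferes with a given message of the typical device: the
portion of devices that overlap in time, times the probability of the same frequency. -/
noncomputable def probIoT : ℝ := (p.N * p.betaT * p.lamT) * (p.betaF * p.b / (p.M * p.B))

/-- Probability that an incumbent interferes with a given message of the typical device. -/
noncomputable def probI : ℝ := min 1 (p.BI / (p.M * p.B))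

/-- Density of the interfering IoT devices. -/
noncomputable def lamIoTTilde : ℝ :=
  p.N * p.betaT * p.lamT * (p.betaF * p.b / (p.M * p.B)) * p.lamIoT

/-- Density of the interfering incumbents. -/
noncomputable def lamITilde : ℝ := min 1 (p.BI / (p.M * p.B)) * p.lamI

/-- Normalized incumbent power within the band of an IoT signal. -/
noncomputable def PIHat : ℝ := p.PI * (p.b / p.BI) / p.PIoT

noncomputable def δ : ℝ := 2 / p.α

noncomputable def ξ : ℝ := Real.sin (Real.pi * p.δ) / (p.δ * Real.pi)

/-- The closed form for the success probability. -/
noncomputable def nearestClosedForm : ℝ :=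
  1 - ∑ k ∈ Finset.range (p.N + 1), (p.N.choose k : ℝ) * (-1) ^ k *
    (1 + k * p.ξ⁻¹ * p.τ ^ p.δ *
      ((p.lamIoTTilde + p.PIHat ^ p.δ * p.lamITilde) / p.lamB))⁻¹

end Params

section Network

variable {Ω κ ι ι' : Type*} [MeasurableSpace Ω]

/-- The random elements of the network seen by a typical device at the origin. Base stations are
indexed by `κ`, IoT devices by `ι`, incumbents by `ι'`. The populations carry the number `i` of the
transmission during which they are observed; they may or may not be the same for all `i`. -/
structure Network (Ω κ ι ι' : Type*) (N : ℕ) where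
  /-- locations of the base stations -/
  bs : κ → Ω → Plane
  /-- fading gain `h` of the `i`-th transmission from the typical device to a base station -/
  gain : Fin N → κ → Ω → ℝ
  /-- locations of the IoT devices -/
  iot : Fin N → ι → Ω → Plane
  /-- the event that an IoT device interferes with the `i`-th transmission -/
  iotActive : Fin N → ι → Set Ω
  /-- fading gain from an IoT device to a base station -/
  iotFading : Fin N → ι → κ → Ω → ℝ
  /-- locations of the incumbents -/
  inc : Fin N → ι' → Ω → Plane
  /-- the event that an incumbent interferes with the `i`-th transmission -/
  incActive : Fin N → ι' → Set Ω
  /-- fading gain from an incumbent to a base station -/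
  incFading : Fin N → ι' → κ → Ω → ℝ

/-- The sources of randomness: the base stations, the fading gains of the typical device, and for
each transmission the set of interfering IoT devices and the set of interfering incumbents. -/
inductive Source (κ : Type*) (N : ℕ) where
  | stations : Source κ N
  | gain (i : Fin N) (j : κ) : Source κ N
  | iot (i : Fin N) : Source κ N
  | inc (i : Fin N) : Source κ N

namespace Network

variable {N : ℕ}

/-- The sigma-algebras generated by the sources of randomness. -/
@[reducible] noncomputable def sourceSigma (W : Network Ω κ ι ι' N) : Source κ N → MeasurableSpace Ω
  | .stations => MeasurableSpace.comap (fun ω j => W.bs j ω) inferInstance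
  | .gain i j => MeasurableSpace.comap (W.gain i j) inferInstance
  | .iot i => MeasurableSpace.comap
      (thinned (W.iot i) (W.iotActive i) (W.iotFading i)) inferInstance
  | .inc i => MeasurableSpace.comap
      (thinned (W.inc i) (W.incActive i) (W.incFading i)) inferInstance

/-- The `SINR` of the `i`-th transmission at the base station `j`, where `nHat` is the normalized
noise power (noise power divided by the transmit power of an IoT device). -/
noncomputable def sinr (p : Params) (W : Network Ω κ ι ι' N) (nHat : ℝ) (i : Fin N) (j : κ)
    (ω : Ω) : ℝ≥0∞ :=
  ENNReal.ofReal (W.gain i j ω) * pathLoss p.α 0 (W.bs j ω) /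
    (ENNReal.ofReal nHat
      + interference p.α (W.iot i) (W.iotActive i) (W.iotFading i) j (W.bs j ω) ω
      + ENNReal.ofReal p.PIHat *
          interference p.α (W.inc i) (W.incActive i) (W.incFading i) j (W.bs j ω) ω)

/-- Success under nearest base station association: the base station nearest to the typical device
decodes at least one of the `N` transmissions. -/
def nearestSuccess (p : Params) (W : Network Ω κ ι ι' N) (nHat : ℝ) : Set Ω :=
  {ω | ∃ j, (∀ j', ‖W.bs j ω‖ ≤ ‖W.bs j' ω‖) ∧ ∃ i, ENNReal.ofReal p.τ < W.sinr p nHat i j ω}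

/-- The benchmark protocol (every base station listens to all the `M` bands) with random
repetition: different transmissions meet independent sets of interferers. -/
structure IsBenchmarkRandom (p : Params) (P : Measure Ω) (W : Network Ω κ ι ι' p.N) : Prop where
  stations : IsHPPP P W.bs p.lamB
  measurable_gain : ∀ i j, Measurable (W.gain i j)
  law_gain : ∀ i j, P.map (W.gain i j) = expMeasure 1
  iot : ∀ i, IsThinnedFadedHPPP P (W.iot i) (W.iotActive i) (W.iotFading i) p.lamIoT p.probIoT
  inc : ∀ i, IsThinnedFadedHPPP P (W.inc i) (W.incActive i) (W.incFading i) p.lamI p.probI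
  indep : iIndep W.sourceSigma P

end Network

end Network

end UNB

/-! Freeze the base stations and let the nearest one lie at distance `r`. Since the gain is
exponential, a transmission is decoded with probability `E exp (-s (noise + interference))`, where
`s = τ r ^ α`. The Laplace functional of a Poisson process, with each point averaged over its
retention and its fading, gives for one population of retained density `lam'` the factor `exp (-lam'
∫ (1 - (1 + s ‖x‖ ^ (-α))⁻¹) dx) = exp (-π ξ⁻¹ s ^ δ lam')`. As `s ^ δ = τ ^ δ r ^ 2`, without noise
the exponent is linear in `t = π lamB r ^ 2`: the probability is `exp (-c t)` with `c = p.load`. The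
transmissions are independent given the stations, so all fail with probability `(1 - exp (-c t)) ^
N`. By the void probabilities `t` is exponential with mean 1, and the binomial formula gives the
sum. Vanishing noise is dominated convergence.

Two points need care. The nearest index is random while independence is available for fixed indices,
so the failure event is split over the disjoint events that `j` is nearest
(`measure_nearestFailure`, `lintegral_nearest`); ties are excluded by `ae_norm_ne`. Independence
between transmissions concerns the counting measures of retained points, not their enumerations, so
the interference has to be a measurable function of that measure (`ae_interferenceOf_thinned`).

The analytic core is `IsHPPP.laplace_functional`, its thinned version and
`lintegral_one_sub_inv_one_add_pathLoss`. Working in `[0, ∞]` avoids summability questions. -/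

namespace UNB

/-! ### The exponential on `[0, ∞]`. -/

/-- The function `a ↦ exp (-a)` on `[0, ∞]`. -/
noncomputable def expNeg (a : ℝ≥0∞) : ℝ≥0∞ := EReal.exp (-(a : EReal))

@[simp] lemma expNeg_zero : expNeg 0 = 1 := by simp [expNeg]

@[simp] lemma expNeg_top : expNeg ∞ = 0 := by simp [expNeg]

lemma expNeg_ofReal {x : ℝ} (hx : 0 ≤ x) :
    expNeg (ENNReal.ofReal x) = ENNReal.ofReal (Real.exp (-x)) := by
  rw [expNeg, EReal.coe_ennreal_ofReal, max_eq_left hx, ← EReal.coe_neg, EReal.exp_coe]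

lemma expNeg_add (a b : ℝ≥0∞) : expNeg (a + b) = expNeg a * expNeg b := by
  rw [expNeg, expNeg, expNeg, ← EReal.exp_add, EReal.coe_ennreal_add, EReal.neg_add,
    sub_eq_add_neg]
  · left; exact EReal.coe_ennreal_ne_bot a
  · right; exact EReal.coe_ennreal_ne_bot b

lemma expNeg_sum {ι : Type*} (s : Finset ι) (a : ι → ℝ≥0∞) :
    expNeg (∑ i ∈ s, a i) = ∏ i ∈ s, expNeg (a i) := by
  classical
  induction s using Finset.induction_on with
  | empty => simp
  | insert i s hi ih => rw [Finset.sum_insert hi, Finset.prod_insert hi, expNeg_add, ih]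

lemma expNeg_nsmul (n : ℕ) (a : ℝ≥0∞) : expNeg (n * a) = expNeg a ^ n := by
  have := expNeg_sum (Finset.range n) (fun _ => a)
  simpa using this

lemma continuous_expNeg : Continuous expNeg :=
  ENNReal.continuous_exp.comp (continuous_neg.comp continuous_coe_ennreal_ereal)

@[fun_prop]
lemma measurable_expNeg : Measurable expNeg := continuous_expNeg.measurable

lemma expNeg_antitone : Antitone expNeg := fun _ _ h =>
  EReal.exp_monotone (EReal.neg_le_neg_iff.2 (EReal.coe_ennreal_le_coe_ennreal_iff.2 h))

lemma expNeg_le_one (a : ℝ≥0∞) : expNeg a ≤ 1 := by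
  simpa using expNeg_antitone (zero_le : 0 ≤ a)

/-- The inverse of `expNeg` on `[0, 1]`. -/
noncomputable def negLog (w : ℝ≥0∞) : ℝ≥0∞ := (-(ENNReal.log w)).toENNReal

@[fun_prop]
lemma measurable_negLog : Measurable negLog := by
  unfold negLog
  exact measurable_ereal_toENNReal.comp (ENNReal.measurable_log.neg)

lemma expNeg_negLog {w : ℝ≥0∞} (hw : w ≤ 1) : expNeg (negLog w) = w := by
  have h : 0 ≤ -(ENNReal.log w) := by
    rw [EReal.neg_nonneg]
    simpa using ENNReal.log_monotone hw
  rw [expNeg, negLog, EReal.coe_toENNReal h, neg_neg, ENNReal.exp_log]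

/-! ### The exponential law with mean 1. -/

section Exponential

lemma expMeasure_one_ofReal_gt (a : ℝ≥0∞) :
    expMeasure 1 {x | a < ENNReal.ofReal x} = expNeg a := by
  have := isProbabilityMeasure_expMeasure one_pos
  induction a using ENNReal.recTopCoe with
  | top => simp
  | coe a =>
    have h : {x : ℝ | (a : ℝ≥0∞) < ENNReal.ofReal x} = (Set.Iic (a : ℝ))ᶜ := by
      ext x
      simp [ENNReal.lt_ofReal_iff_toReal_lt]
    have h2 := cdf_expMeasure_eq one_pos (a : ℝ)
    rw [cdf_eq_real, if_pos a.coe_nonneg, one_mul] at h2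
    rw [h, prob_compl_eq_one_sub measurableSet_Iic, ← ENNReal.ofReal_coe_nnreal,
      expNeg_ofReal a.coe_nonneg, ← ofReal_measureReal, h2, ← ENNReal.ofReal_one,
      ← ENNReal.ofReal_sub]
    · ring_nf
    · have : Real.exp (-(a:ℝ)) ≤ 1 := by simp
      linarith

lemma ae_expMeasure_one_pos : ∀ᵐ t ∂(expMeasure 1), 0 < t := by
  have := isProbabilityMeasure_expMeasure one_pos
  have h0 := expMeasure_one_ofReal_gt 0
  simp only [ENNReal.ofReal_pos, expNeg_zero] at h0
  exact (mem_ae_iff_prob_eq_one measurableSet_Ioi).2 h0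

lemma lintegral_expMeasure (r : ℝ) {g : ℝ → ℝ≥0∞} (hg : Measurable g) :
    ∫⁻ x, g x ∂(expMeasure r) = ∫⁻ x, exponentialPDF r x * g x := by
  have h : Measurable (exponentialPDF r) := (measurable_exponentialPDFReal r).ennreal_ofReal
  exact lintegral_withDensity_eq_lintegral_mul _ h hg

/-- Tilting the density of rate 1 by `exp (-a x)` leaves `(1 + a)⁻¹` times the density of rate `1 +
a`. It serves twice: to average over the fading, and backwards, to write a reciprocal as an integral
of exponentials. -/
lemma lintegral_expNeg_expMeasure (a : ℝ≥0∞) :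
    ∫⁻ x, expNeg (a * ENNReal.ofReal x) ∂(expMeasure 1) = (1 + a)⁻¹ := by
  rw [lintegral_expMeasure _ (by fun_prop)]
  induction a using ENNReal.recTopCoe with
  | top =>
    rw [add_top, ENNReal.inv_top, lintegral_eq_zero_iff' (by
      refine AEMeasurable.mul ?_ (by fun_prop)
      exact (measurable_exponentialPDFReal 1).ennreal_ofReal.aemeasurable)]
    -- At `x = 0` the convention `∞ * 0 = 0` makes the integrand nonzero.
    have h0 : ∀ᵐ x : ℝ, x ≠ 0 := by simp [ae_iff]
    filter_upwards [h0] with x hx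
    rcases hx.lt_or_gt with hx | hx
    · simp [exponentialPDF_of_neg hx]
    · simp [ENNReal.top_mul, hx]
  | coe a =>
    have ha : (0 : ℝ) < 1 + a := by positivity
    have key : ∀ x : ℝ, exponentialPDF 1 x * expNeg (a * ENNReal.ofReal x) =
        (1 + (a : ℝ≥0∞))⁻¹ * exponentialPDF (1 + a) x := by
      intro x
      rcases lt_or_ge x 0 with hx | hx
      · simp [exponentialPDF_of_neg hx]
      · have e : (1 + (a : ℝ≥0∞)) = ENNReal.ofReal (1 + a) := by
          rw [ENNReal.ofReal_add zero_le_one a.coe_nonneg]; simp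
        rw [exponentialPDF_of_nonneg hx, exponentialPDF_of_nonneg hx, ← ENNReal.ofReal_coe_nnreal,
          ← ENNReal.ofReal_mul a.coe_nonneg, expNeg_ofReal (by positivity),
          ENNReal.ofReal_coe_nnreal, e, ← ENNReal.ofReal_inv_of_pos ha,
          ← ENNReal.ofReal_mul (by positivity), ← ENNReal.ofReal_mul (by positivity),
          inv_mul_cancel_left₀ ha.ne', one_mul, one_mul, ← Real.exp_add]
        ring_nf
    simp_rw [key]
    rw [lintegral_const_mul' _ _ (by simp)]
    rw [lintegral_exponentialPDF_eq_one ha, mul_one]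

end Exponential

/-- Sigma-algebras generated by disjoint groups of independent sigma-algebras are independent. -/
lemma iIndep_iSup_of_pairwise_disjoint {Ω I J : Type*} {m0 : MeasurableSpace Ω} {μ : Measure Ω}
    {m : I → MeasurableSpace Ω} (hle : ∀ i, m i ≤ m0) (h : iIndep m μ) {S : J → Set I}
    (hS : Pairwise (Function.onFun Disjoint S)) : iIndep (fun j => ⨆ i ∈ S j, m i) μ := by
  classical
  have := h.isProbabilityMeasure
  rw [iIndep_iff]
  intro s
  induction s using Finset.induction_on with
  | empty => simp
  | insert a s ha ih =>
    intro f hf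
    rw [Finset.set_biInter_insert, Finset.prod_insert ha,
      ← ih (fun i hi => hf i (Finset.mem_insert_of_mem hi))]
    -- The new group is independent of the supremum over the union of all the earlier ones, which
    -- contains their intersection event.
    have hd : Disjoint (S a) (⋃ j ∈ s, S j) := by
      simp only [Set.disjoint_iUnion_right]
      exact fun j hj => hS (fun e => ha (e ▸ hj))
    have hi := indep_iSup_of_disjoint hle h hd
    refine (Indep_iff _ _ μ).1 hi _ _ (hf a (Finset.mem_insert_self a s)) ?_
    refine Finset.measurableSet_biInter s fun j hj => ?_
    refine (?_ : (⨆ i ∈ S j, m i) ≤ _) _ (hf j (Finset.mem_insert_of_mem hj))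
    exact biSup_mono fun i hi => Set.mem_biUnion hj hi

/-! ### Laplace functional of a Poisson process. -/

section PointProcess

variable {Ω ι : Type*}

/-- The random counting measure of the points enumerated by `X`. -/
noncomputable def pointMeasure (X : ι → Ω → Plane) (ω : Ω) : Measure Plane :=
  Measure.sum fun u => Measure.dirac (X u ω)

lemma lintegral_pointMeasure (X : ι → Ω → Plane) (ω : Ω) {φ : Plane → ℝ≥0∞} (hφ : Measurable φ) :
    ∫⁻ x, φ x ∂(pointMeasure X ω) = ∑' u, φ (X u ω) := by
  rw [pointMeasure, lintegral_sum_measure]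
  exact tsum_congr fun u => lintegral_dirac' _ hφ

lemma pointMeasure_apply (X : ι → Ω → Plane) (ω : Ω) {A : Set Plane} (hA : MeasurableSet A) :
    pointMeasure X ω A = (pointCount X A ω : ℝ≥0∞) := by
  rw [pointMeasure, Measure.sum_apply _ hA, pointCount, ← ENNReal.tsum_set_one,
    tsum_subtype {u | X u ω ∈ A} (fun _ => (1 : ℝ≥0∞))]
  refine tsum_congr fun u => ?_
  rw [Measure.dirac_apply' _ hA]
  rfl

variable [MeasurableSpace Ω] {P : Measure Ω} {X : ι → Ω → Plane} {lam : ℝ}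

lemma IsHPPP.measurable_pointCount [Countable ι] (h : IsHPPP P X lam) {A : Set Plane}
    (hA : MeasurableSet A) : Measurable (pointCount X A) := by
  have h1 : Measurable fun ω => (pointCount X A ω : ℝ≥0∞) := by
    simp_rw [← pointMeasure_apply X _ hA, ← lintegral_indicator_one hA]
    have hm : Measurable (A.indicator (1 : Plane → ℝ≥0∞)) := measurable_one.indicator hA
    simp_rw [lintegral_pointMeasure X _ hm]
    exact Measurable.tsum fun u => hm.comp (h.measurable_point u)
  refine measurable_to_countable' fun n => ?_
  have : pointCount X A ⁻¹' {n} = (fun ω => (pointCount X A ω : ℝ≥0∞)) ⁻¹' {(n : ℝ≥0∞)} := by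
    ext ω; simp
  rw [this]
  exact h1 (measurableSet_singleton _)

/-- The definition prescribes only the probabilities of finite counts; total mass one then
determines the mass at `⊤`. -/
lemma IsHPPP.map_pointCount [Countable ι] [IsProbabilityMeasure P] (h : IsHPPP P X lam)
    {A : Set Plane} (hA : MeasurableSet A) (hb : Bornology.IsBounded A) :
    P.map (pointCount X A) =
      (poissonMeasure (lam * (volume A).toReal).toNNReal).map (Nat.cast : ℕ → ℕ∞) := by
  have hm := h.measurable_pointCount hA
  set r := (lam * (volume A).toReal).toNNReal
  have hsing : ∀ k : ℕ, P.map (pointCount X A) {(k : ℕ∞)} = poissonMeasure r {k} := by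
    intro k
    rw [Measure.map_apply hm (measurableSet_singleton _)]
    exact h.poisson_count A hA hb k
  have hsing' : ∀ k : ℕ, (poissonMeasure r).map (Nat.cast : ℕ → ℕ∞) {(k : ℕ∞)} =
      poissonMeasure r {k} := by
    intro k
    rw [Measure.map_apply measurable_from_top (measurableSet_singleton _)]
    congr 1
    ext n; simp
  have := Measure.isProbabilityMeasure_map (μ := P) hm.aemeasurable
  have := Measure.isProbabilityMeasure_map (μ := poissonMeasure r)
    (f := (Nat.cast : ℕ → ℕ∞)) measurable_from_top.aemeasurable
  have htop : ∀ ν : Measure ℕ∞, IsProbabilityMeasure ν → ν {⊤} = 1 - ∑' k : ℕ, ν {(k : ℕ∞)} := by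
    intro ν _
    have e : ({⊤} : Set ℕ∞) = (⋃ k : ℕ, {(k : ℕ∞)})ᶜ := by
      ext n
      induction n using ENat.recTopCoe <;> simp
    rw [e, prob_compl_eq_one_sub (MeasurableSet.of_discrete), measure_iUnion]
    · intro i j hij
      simpa using hij
    · exact fun _ => MeasurableSet.of_discrete
  refine Measure.ext_of_singleton fun n => ?_
  induction n using ENat.recTopCoe with
  | top => rw [htop _ inferInstance, htop _ inferInstance]; simp_rw [hsing, hsing']
  | coe k => rw [hsing, hsing']

/-- Tilting by `exp (-a k)` turns the Poisson law of mean `r` into a multiple of the one of mean `r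
exp (-a)`. -/
lemma lintegral_expNeg_poissonMeasure (r : ℝ≥0) (a : ℝ≥0∞) :
    ∫⁻ k : ℕ, expNeg (k * a) ∂(poissonMeasure r) = expNeg (r * (1 - expNeg a)) := by
  obtain ⟨c, hc⟩ : ∃ c : ℝ≥0, (c : ℝ≥0∞) = expNeg a :=
    ⟨(expNeg a).toNNReal, ENNReal.coe_toNNReal ((expNeg_le_one a).trans_lt ENNReal.one_lt_top).ne⟩
  have hc1 : c ≤ 1 := by exact_mod_cast hc.trans_le (expNeg_le_one a)
  have hc1' : (c : ℝ) ≤ 1 := hc1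
  simp_rw [expNeg_nsmul]
  rw [← hc, lintegral_countable']
  have e : (r : ℝ≥0∞) * (1 - c) = ENNReal.ofReal (r * (1 - c)) := by
    rw [ENNReal.ofReal_mul r.coe_nonneg, ENNReal.ofReal_sub _ c.coe_nonneg]
    simp
  have key : ∀ k : ℕ, (c : ℝ≥0∞) ^ k * poissonMeasure r {k} =
      expNeg (r * (1 - c)) * poissonMeasure (r * c) {k} := by
    intro k
    rw [poissonMeasure_singleton, poissonMeasure_singleton, e,
      expNeg_ofReal (mul_nonneg r.coe_nonneg (by linarith)), ← ENNReal.ofReal_coe_nnreal,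
      ← ENNReal.ofReal_pow c.coe_nonneg, ← ENNReal.ofReal_mul (by positivity),
      ← ENNReal.ofReal_mul (by positivity)]
    congr 1
    have : Real.exp (-(r : ℝ)) = Real.exp (-(r * (1 - c) : ℝ)) * Real.exp (-((r * c : ℝ≥0) : ℝ)) := by
      rw [← Real.exp_add]; push_cast; ring_nf
    rw [this]
    push_cast
    ring
  simp_rw [key]
  rw [ENNReal.tsum_mul_left, show ∑' k : ℕ, poissonMeasure (r * c) {k} = 1 from ?_, mul_one]
  have := lintegral_countable' (μ := poissonMeasure (r * c)) (fun _ => 1)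
  simpa using this.symm

lemma IsHPPP.lintegral_expNeg_pointCount [Countable ι] [IsProbabilityMeasure P]
    (h : IsHPPP P X lam) {A : Set Plane} (hA : MeasurableSet A)
    (hb : Bornology.IsBounded A) (a : ℝ≥0∞) :
    ∫⁻ ω, expNeg ((pointCount X A ω : ℝ≥0∞) * a) ∂P =
      expNeg (ENNReal.ofReal lam * volume A * (1 - expNeg a)) := by
  rw [← lintegral_map (f := fun n : ℕ∞ => expNeg ((n : ℝ≥0∞) * a)) measurable_from_top
    (h.measurable_pointCount hA), h.map_pointCount hA hb,
    lintegral_map measurable_from_top measurable_from_top]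
  simp only [ENat.toENNReal_coe]
  rw [lintegral_expNeg_poissonMeasure]
  have hfin : volume A ≠ ∞ := hb.measure_lt_top.ne
  rw [show ((lam * (volume A).toReal).toNNReal : ℝ≥0∞) = ENNReal.ofReal lam * volume A from ?_]
  calc _ = ENNReal.ofReal (lam * (volume A).toReal) := rfl
    _ = _ := by rw [ENNReal.ofReal_mul' ENNReal.toReal_nonneg, ENNReal.ofReal_toReal hfin]

/-- The sum over the points is a finite combination of counts in disjoint level sets, which are
independent and Poisson, so the transform factorizes. -/
lemma IsHPPP.laplace_functional_simpleFunc [Countable ι] [IsProbabilityMeasure P]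
    (h : IsHPPP P X lam) (φ : SimpleFunc Plane ℝ≥0∞) (hb : Bornology.IsBounded {x | φ x ≠ 0}) :
    ∫⁻ ω, expNeg (∑' u, φ (X u ω)) ∂P =
      expNeg (ENNReal.ofReal lam * ∫⁻ x, (1 - expNeg (φ x))) := by
  -- The value `0` is dropped because its level set is unbounded and its count is not controlled.
  set F := φ.range.filter (· ≠ 0)
  set A : F → Set Plane := fun y => φ ⁻¹' {(y : ℝ≥0∞)}
  have hA : ∀ y, MeasurableSet (A y) := fun y => φ.measurableSet_preimage _
  have hAb : ∀ y, Bornology.IsBounded (A y) := fun y => hb.subset fun x hx => by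
    have hx' : φ x = y := hx
    show φ x ≠ 0
    rw [hx']
    exact (Finset.mem_filter.1 y.2).2
  have hAd : Pairwise fun y y' => Disjoint (A y) (A y') := fun y y' hyy' =>
    Set.disjoint_left.2 fun x hx hx' => hyy' (Subtype.ext ((show φ x = y from hx).symm.trans hx'))
  have hsum : ∀ (g : ℝ≥0∞ → ℝ≥0∞) (_ : g 0 = 0) (ν : Measure Plane),
      ∫⁻ x, g (φ x) ∂ν = ∑ y : F, g y * ν (A y) := by
    intro g hg ν
    have := SimpleFunc.lintegral_eq_lintegral (φ.map g) ν
    rw [SimpleFunc.map_lintegral] at this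
    rw [Finset.sum_coe_sort F (fun y => g y * ν (φ ⁻¹' {y})), Finset.sum_filter_of_ne, ← this]
    · rfl
    · rintro y _ hy rfl
      simp [hg] at hy
  have hL : ∀ ω, expNeg (∑' u, φ (X u ω)) =
      ∏ y : F, expNeg ((pointCount X (A y) ω : ℝ≥0∞) * y) := by
    intro ω
    rw [← lintegral_pointMeasure X ω φ.measurable, hsum (fun y => y) rfl, expNeg_sum]
    refine Finset.prod_congr rfl fun y _ => ?_
    rw [pointMeasure_apply X ω (hA y), mul_comm]
  simp_rw [hL]
  rw [hsum (fun y => 1 - expNeg y) (by simp), Finset.mul_sum, expNeg_sum]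
  -- Independence of the counts is given for families indexed by `Fin n`.
  set e := F.equivFin
  have hi := h.indep_count F.card (fun m => A (e.symm m)) (fun _ => hA _) (fun _ => hAb _)
    (fun m m' hmm' => hAd (fun he => hmm' (e.symm.injective he)))
  have hi' := hi.comp (fun m n => expNeg ((n : ℝ≥0∞) * (e.symm m : ℝ≥0∞)))
    (fun m => measurable_from_top)
  have hprod := lintegral_prod_eq_prod_lintegral_of_indepFun Finset.univ _ hi'
    (fun m => measurable_from_top.comp (h.measurable_pointCount (hA _)))
  simp only [Function.comp_apply] at hprod
  rw [Equiv.prod_comp e.symm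
    (fun y => ∫⁻ ω, expNeg ((pointCount X (A y) ω : ℝ≥0∞) * (y : ℝ≥0∞)) ∂P)] at hprod
  simp_rw [fun ω => Equiv.prod_comp e.symm
    (fun y => expNeg ((pointCount X (A y) ω : ℝ≥0∞) * (y : ℝ≥0∞)))] at hprod
  rw [hprod]
  refine Finset.prod_congr rfl fun y _ => ?_
  rw [h.lintegral_expNeg_pointCount (hA y) (hAb y), mul_assoc, mul_comm (volume _)]

/-- The Laplace functional of a homogeneous Poisson point process. -/
theorem IsHPPP.laplace_functional [Countable ι] [IsProbabilityMeasure P]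
    (h : IsHPPP P X lam) {φ : Plane → ℝ≥0∞} (hφ : Measurable φ) :
    ∫⁻ ω, expNeg (∑' u, φ (X u ω)) ∂P =
      expNeg (ENNReal.ofReal lam * ∫⁻ x, (1 - expNeg (φ x))) := by
  -- The growing balls provide the bounded support needed for simple functions and keep the
  -- approximation monotone.
  set f : ℕ → SimpleFunc Plane ℝ≥0∞ := fun n =>
    (SimpleFunc.eapprox φ n).restrict (Metric.ball 0 n)
  have hf : ∀ n x, f n x = (Metric.ball (0 : Plane) n).indicator (SimpleFunc.eapprox φ n) x :=
    fun n x => by rw [SimpleFunc.restrict_apply _ Metric.isOpen_ball.measurableSet]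
  have hmono : ∀ x, Monotone fun n => f n x := by
    intro x n m hnm
    simp only [hf]
    refine (Set.indicator_le_indicator_of_subset
      (Metric.ball_subset_ball (Nat.cast_le.2 hnm)) (fun _ => zero_le) x).trans ?_
    exact Set.indicator_le_indicator (SimpleFunc.monotone_eapprox φ hnm x)
  have hlim : ∀ x, Tendsto (fun n => f n x) atTop (𝓝 (φ x)) := by
    intro x
    refine (SimpleFunc.tendsto_eapprox hφ x).congr' ?_
    obtain ⟨n, hn⟩ := exists_nat_gt ‖x‖
    filter_upwards [eventually_ge_atTop n] with m hm
    rw [hf, Set.indicator_of_mem]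
    simpa using hn.trans_le (Nat.cast_le.2 hm)
  have hleft : Tendsto (fun n => ∫⁻ ω, expNeg (∑' u, f n (X u ω)) ∂P) atTop
      (𝓝 (∫⁻ ω, expNeg (∑' u, φ (X u ω)) ∂P)) := by
    refine tendsto_lintegral_of_dominated_convergence (fun _ => 1)
      (fun n => measurable_expNeg.comp
        (Measurable.tsum fun u => (f n).measurable.comp (h.measurable_point u)))
      (fun n => ae_of_all _ fun ω => expNeg_le_one _) (by simp) (ae_of_all _ fun ω => ?_)
    refine (continuous_expNeg.tendsto _).comp ?_
    simp_rw [← lintegral_pointMeasure X ω hφ, ← lintegral_pointMeasure X ω (f _).measurable]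
    exact lintegral_tendsto_of_tendsto_of_monotone (fun n => (f n).measurable.aemeasurable)
      (ae_of_all _ hmono) (ae_of_all _ hlim)
  have hright : Tendsto (fun n => ∫⁻ x, (1 - expNeg (f n x))) atTop
      (𝓝 (∫⁻ x, (1 - expNeg (φ x)))) := by
    refine lintegral_tendsto_of_tendsto_of_monotone
      (fun n => (measurable_const.sub (measurable_expNeg.comp (f n).measurable)).aemeasurable)
      (ae_of_all _ fun x n m hnm => tsub_le_tsub_left (expNeg_antitone (hmono x hnm)) _)
      (ae_of_all _ fun x => ?_)
    exact ENNReal.Tendsto.sub tendsto_const_nhds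
      ((continuous_expNeg.tendsto _).comp (hlim x)) (Or.inl ENNReal.one_ne_top)
  have hright' := (continuous_expNeg.tendsto _).comp
    (ENNReal.Tendsto.const_mul hright (Or.inr (ENNReal.ofReal_ne_top (r := lam))))
  refine tendsto_nhds_unique (hleft.congr fun n => ?_) hright'
  refine h.laplace_functional_simpleFunc (f n) 
    ((Metric.isBounded_ball (x := (0 : Plane)) (r := n)).subset fun x hx => ?_)
  by_contra hx'
  exact hx (by rw [hf, Set.indicator_of_notMem hx'])

end PointProcess

/-! ### Independent thinning and fading. -/

section PointProcess

variable {Ω ι κ : Type*} {X : ι → Ω → Plane} {act : ι → Set Ω} {f : ι → κ → Ω → ℝ} {lam p : ℝ}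

/-- The fading gain of the transmitter `u` at the receiver `j`, set to `0` if `u` is not retained. -/
noncomputable def activeFading (act : ι → Set Ω) (f : ι → κ → Ω → ℝ) (j : κ) (u : ι) : Ω → ℝ≥0∞ :=
  (act u).indicator fun ω => ENNReal.ofReal (f u j ω)

lemma measurable_activeFading_iSup {S : Set (MarkSource ι κ)} {j : κ} {u : ι}
    (h1 : MarkSource.retained u ∈ S) (h2 : MarkSource.fading u j ∈ S) :
    Measurable[⨆ i ∈ S, markSigma X act f i] (activeFading act f j u) := by
  have a1 := le_biSup (markSigma X act f) h1
  have a2 := le_biSup (markSigma X act f) h2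
  refine Measurable.indicator ?_ (a1 _ (MeasurableSpace.measurableSet_generateFrom rfl))
  exact ENNReal.measurable_ofReal.comp ((comap_measurable (f u j)).mono a2 le_rfl)

variable [MeasurableSpace Ω] {P : Measure Ω}

lemma IsThinnedFadedHPPP.markSigma_le (h : IsThinnedFadedHPPP P X act f lam p)
    (s : MarkSource ι κ) : markSigma X act f s ≤ (inferInstance : MeasurableSpace Ω) := by
  cases s with
  | locations => exact (measurable_pi_lambda _ h.hppp.measurable_point).comap_le
  | retained u =>
    refine MeasurableSpace.generateFrom_le fun t ht => ?_
    rw [Set.mem_singleton_iff.1 ht]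
    exact h.measurableSet_act u
  | fading u j => exact (h.measurable_fading u j).comap_le

lemma IsThinnedFadedHPPP.measurable_activeFading (h : IsThinnedFadedHPPP P X act f lam p)
    (j : κ) (u : ι) : Measurable (activeFading act f j u) :=
  ((h.measurable_fading u j).ennreal_ofReal).indicator (h.measurableSet_act u)

/-- For different `u` the variables use disjoint groups of sources, one retention and one fading
gain each. -/
lemma IsThinnedFadedHPPP.iIndepFun_activeFading (h : IsThinnedFadedHPPP P X act f lam p) (j : κ) :
    iIndepFun (activeFading act f j) P := by
  have hd : Pairwise (Function.onFun Disjoint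
      fun u : ι => ({.retained u, .fading u j} : Set (MarkSource ι κ))) := by
    intro u u' huu'
    simp [Function.onFun, huu'.symm]
  refine iIndep_of_iIndep_of_le (iIndep_iSup_of_pairwise_disjoint h.markSigma_le h.indep hd) ?_
  exact fun u => (measurable_activeFading_iSup (by simp) (by simp)).comap_le

lemma IsThinnedFadedHPPP.indepFun_locations (h : IsThinnedFadedHPPP P X act f lam p) (j : κ) :
    IndepFun (fun ω u => X u ω) (fun ω u => activeFading act f j u ω) P := by
  have hd : Disjoint ({.locations} : Set (MarkSource ι κ)) {.locations}ᶜ := disjoint_compl_right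
  have hle : markSigma X act f .locations ≤
      ⨆ i ∈ ({.locations} : Set (MarkSource ι κ)), markSigma X act f i :=
    le_iSup₂_of_le .locations rfl le_rfl
  refine indep_of_indep_of_le (indep_iSup_of_disjoint h.markSigma_le h.indep hd)
    hle ?_
  refine Measurable.comap_le (@measurable_pi_lambda _ _ _ (_) _ _ fun u => ?_)
  exact measurable_activeFading_iSup (by simp) (by simp)

variable [IsProbabilityMeasure P]

/-- A retained transmitter contributes `(1 + c)⁻¹`, the Laplace transform of its fading; a deleted
one contributes `1`. -/
lemma IsThinnedFadedHPPP.lintegral_expNeg_activeFading (h : IsThinnedFadedHPPP P X act f lam p)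
    (j : κ) (u : ι) (c : ℝ≥0∞) :
    ∫⁻ ω, expNeg (c * activeFading act f j u ω) ∂P =
      ENNReal.ofReal p * (1 + c)⁻¹ + (1 - ENNReal.ofReal p) := by
  have e : ∀ ω, expNeg (c * activeFading act f j u ω) =
      (act u).indicator 1 ω * expNeg (c * ENNReal.ofReal (f u j ω)) + (act u)ᶜ.indicator 1 ω := by
    intro ω
    by_cases hω : ω ∈ act u <;> simp [activeFading, hω]
  have hm := h.measurableSet_act u
  have hf := h.measurable_fading u j
  simp_rw [e]
  rw [lintegral_add_right _ (measurable_one.indicator hm.compl), lintegral_indicator_one hm.compl,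
    prob_compl_eq_one_sub hm, h.prob_act,
    lintegral_mul_eq_lintegral_mul_lintegral_of_independent_measurableSpace
      (h.markSigma_le (.retained u)) (h.markSigma_le (.fading u j)) (h.indep.indep (by simp)),
    lintegral_indicator_one hm, h.prob_act,
    ← lintegral_map (f := fun x => expNeg (c * ENNReal.ofReal x)) (by fun_prop) hf,
    h.law_fading, lintegral_expNeg_expMeasure]
  · exact Measurable.indicator (@measurable_const _ _ _ (_) 1)
      (MeasurableSpace.measurableSet_generateFrom rfl)
  · exact Measurable.comp (g := fun x => expNeg (c * ENNReal.ofReal x)) (by fun_prop)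
      (comap_measurable (f u j))

variable [Countable ι]

/-- Testing with `φ = ∞`: the empty sum gives `1`, a positive density would give `0`. Without
transmitters nothing forces `p ≤ 1`, so the thinned functional needs this case separately. -/
lemma IsHPPP.density_nonpos_of_isEmpty [IsEmpty ι] (h : IsHPPP P X lam) : ENNReal.ofReal lam = 0 := by
  have := h.laplace_functional (φ := fun _ => ∞) measurable_const
  by_contra hl
  simp [ENNReal.mul_top hl] at this

/-- The Laplace functional of a thinned homogeneous Poisson point process with exponential fading. -/
theorem IsThinnedFadedHPPP.laplace_functional (h : IsThinnedFadedHPPP P X act f lam p) (j : κ)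
    {g : Plane → ℝ≥0∞} (hg : Measurable g) :
    ∫⁻ ω, expNeg (∑' u, g (X u ω) * activeFading act f j u ω) ∂P =
      expNeg (ENNReal.ofReal lam * ENNReal.ofReal p * ∫⁻ x, (1 - (1 + g x)⁻¹)) := by
  rcases isEmpty_or_nonempty ι with hι | ⟨⟨u₀⟩⟩
  · simp [h.hppp.density_nonpos_of_isEmpty]
  set q := ENNReal.ofReal p
  have hq : q ≤ 1 := (h.prob_act u₀).symm.trans_le prob_le_one
  have hq' : q ≠ ∞ := ENNReal.ofReal_ne_top
  have ha : ∀ c : ℝ≥0∞, (1 + c)⁻¹ ≤ 1 := fun c => ENNReal.inv_le_one.2 le_self_add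
  have hsum : ∀ c : ℝ≥0∞, q * (1 - (1 + c)⁻¹) + (q * (1 + c)⁻¹ + (1 - q)) = 1 := by
    intro c
    rw [← add_assoc, ← mul_add, tsub_add_cancel_of_le (ha c), mul_one, add_tsub_cancel_of_le hq]
  have hv : ∀ c : ℝ≥0∞, q * (1 + c)⁻¹ + (1 - q) ≤ 1 := fun c => by
    conv_rhs => rw [← hsum c]
    exact le_add_self
  -- `exp (-φ x)` is the mean contribution of a transmitter at `x`; averaging over the marks thus
  -- reduces the claim to the functional of the unthinned process at `φ`.
  set φ : Plane → ℝ≥0∞ := fun x => negLog (q * (1 + g x)⁻¹ + (1 - q))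
  have hφ : Measurable φ := by fun_prop
  have hφe : ∀ x, expNeg (φ x) = q * (1 + g x)⁻¹ + (1 - q) := fun x => expNeg_negLog (hv _)
  have hX := h.hppp.measurable_point
  have hT := h.measurable_activeFading j
  -- Given the locations, the product formula over independent marks holds for finite sets of
  -- transmitters; the full sum is reached by `hlim`.
  have hfin : ∀ S : Finset ι, ∫⁻ ω, expNeg (∑ u ∈ S, g (X u ω) * activeFading act f j u ω) ∂P =
      ∫⁻ ω, expNeg (∑ u ∈ S, φ (X u ω)) ∂P := by
    intro S
    have hXm : Measurable fun ω u => X u ω := measurable_pi_lambda _ hX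
    have hTm : Measurable fun ω u => activeFading act f j u ω := measurable_pi_lambda _ hT
    have hi := (indepFun_iff_map_prod_eq_prod_map_map hXm.aemeasurable hTm.aemeasurable).1
      (h.indepFun_locations j)
    have := Measure.isProbabilityMeasure_map (μ := P) hTm.aemeasurable
    have hG : Measurable fun y : (ι → Plane) × (ι → ℝ≥0∞) =>
        expNeg (∑ u ∈ S, g (y.1 u) * y.2 u) := by fun_prop
    rw [← lintegral_map (f := fun y : (ι → Plane) × (ι → ℝ≥0∞) =>
        expNeg (∑ u ∈ S, g (y.1 u) * y.2 u)) hG (hXm.prodMk hTm), hi,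
      lintegral_prod _ hG.aemeasurable,
      ← lintegral_map (f := fun y : ι → Plane => expNeg (∑ u ∈ S, φ (y u))) (by fun_prop) hXm]
    refine lintegral_congr fun x => ?_
    rw [lintegral_map (by fun_prop) hTm, expNeg_sum]
    simp_rw [expNeg_sum]
    have hc : ∀ u, Measurable fun t => expNeg (g (x u) * t) := fun u => by fun_prop
    have := lintegral_prod_eq_prod_lintegral_of_indepFun S _
      ((h.iIndepFun_activeFading j).comp (fun u t => expNeg (g (x u) * t)) hc)
      (fun u => (hc u).comp (hT u))
    simp only [Function.comp_apply] at this
    rw [this]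
    refine Finset.prod_congr rfl fun u _ => ?_
    rw [h.lintegral_expNeg_activeFading, hφe]
  have hlim : ∀ F : ι → Ω → ℝ≥0∞, (∀ u, Measurable (F u)) →
      Tendsto (fun S : Finset ι => ∫⁻ ω, expNeg (∑ u ∈ S, F u ω) ∂P) atTop
        (𝓝 (∫⁻ ω, expNeg (∑' u, F u ω) ∂P)) := by
    intro F hF
    refine tendsto_lintegral_filter_of_dominated_convergence (fun _ => 1)
      (Eventually.of_forall fun S => by fun_prop)
      (Eventually.of_forall fun n => ae_of_all _ fun ω => expNeg_le_one _) (by simp)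
      (ae_of_all _ fun ω => ?_)
    exact (continuous_expNeg.tendsto _).comp ENNReal.summable.hasSum
  have h1 := hlim (fun u ω => g (X u ω) * activeFading act f j u ω)
    (fun u => (hg.comp (hX u)).mul (hT u))
  have h2 := hlim (fun u ω => φ (X u ω)) (fun u => hφ.comp (hX u))
  rw [tendsto_nhds_unique h1 (h2.congr fun S => (hfin S).symm), h.hppp.laplace_functional hφ,
    mul_assoc, ← lintegral_const_mul' _ _ hq']
  congr 2
  refine lintegral_congr fun x => ?_
  rw [hφe]
  refine ENNReal.sub_eq_of_eq_add ((hv _).trans_lt ENNReal.one_lt_top).ne (hsum _).symm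

end PointProcess

/-! ### Path loss and the Laplace transform of the interference. -/

section PathLoss

lemma lintegral_plane_exp_neg_mul_rpow {a b : ℝ} (ha : 1 ≤ a) (hb : 0 < b) :
    ∫⁻ x : Plane, ENNReal.ofReal (Real.exp (-b * ‖x‖ ^ a)) =
      ENNReal.ofReal (Real.pi * b ^ (-2 / a) * Real.Gamma (2 / a + 1)) := by
  have hmp := Complex.orthonormalBasisOneI.repr.measurePreserving
  rw [← hmp.lintegral_comp_emb
    Complex.orthonormalBasisOneI.repr.toHomeomorph.measurableEmbedding]
  simp only [LinearIsometryEquiv.norm_map]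
  have hI := Complex.integral_exp_neg_mul_rpow ha hb
  rw [← hI, ofReal_integral_eq_lintegral_ofReal]
  · refine Integrable.of_integral_ne_zero (hI.trans_ne ?_)
    have : 0 < Real.Gamma (2 / a + 1) := Real.Gamma_pos_of_pos (by positivity)
    positivity
  · exact ae_of_all _ fun x => (Real.exp_pos _).le

/-- Up to the factor `Γ (1 - d)`, the integrand against Lebesgue measure is a Gamma density of shape
`1 - d`. -/
lemma lintegral_rpow_neg_expMeasure {d : ℝ} (hd : d < 1) :
    ∫⁻ w, ENNReal.ofReal (w ^ (-d)) ∂(expMeasure 1) = ENNReal.ofReal (Real.Gamma (1 - d)) := by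
  have hG : 0 < Real.Gamma (1 - d) := Real.Gamma_pos_of_pos (by linarith)
  rw [lintegral_expMeasure _ (by fun_prop)]
  have key : ∀ w, exponentialPDF 1 w * ENNReal.ofReal (w ^ (-d)) =
      ENNReal.ofReal (Real.Gamma (1 - d)) * gammaPDF (1 - d) 1 w := by
    intro w
    rcases lt_or_ge w 0 with hw | hw
    · simp [exponentialPDF_of_neg hw, gammaPDF_of_neg hw]
    · rw [exponentialPDF_of_nonneg hw, gammaPDF_of_nonneg hw, ← ENNReal.ofReal_mul (by positivity),
        ← ENNReal.ofReal_mul hG.le]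
      congr 1
      rw [Real.one_rpow, show (1 - d - 1 : ℝ) = -d by ring]
      field_simp
  simp_rw [key]
  rw [lintegral_const_mul' _ _ (by simp), lintegral_gammaPDF_eq_one (by linarith) one_pos, mul_one]

lemma measurable_pathLoss (α : ℝ) : Measurable fun y : Plane × Plane => pathLoss α y.1 y.2 := by
  unfold pathLoss
  fun_prop

/-- In this form the integrand is the Laplace transform of the exponential law at a finite argument,
even at `x = 0`, where the path loss is infinite. -/
lemma one_sub_inv_one_add_pathLoss {α s : ℝ} (hα : 0 < α) (hs : 0 < s) (x : Plane) :
    1 - (1 + ENNReal.ofReal s * pathLoss α x 0)⁻¹ =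
      (1 + ENNReal.ofReal (s⁻¹ * ‖x‖ ^ α))⁻¹ := by
  rw [pathLoss, dist_zero_right]
  rcases eq_or_ne x 0 with rfl | hx
  · simp [ENNReal.zero_rpow_of_neg (neg_lt_zero.2 hα), ENNReal.mul_top, hs, Real.zero_rpow hα.ne']
  · have hn : 0 < ‖x‖ := norm_pos_iff.2 hx
    have hy : 0 < ‖x‖ ^ α := by positivity
    have h1 : (0 : ℝ) ≤ s * ‖x‖ ^ (-α) := by positivity
    have h2 : (0 : ℝ) ≤ s⁻¹ * ‖x‖ ^ α := by positivity
    rw [ENNReal.ofReal_rpow_of_pos hn, ← ENNReal.ofReal_mul hs.le, ← ENNReal.ofReal_one,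
      ← ENNReal.ofReal_add zero_le_one h1, ← ENNReal.ofReal_add zero_le_one h2,
      ← ENNReal.ofReal_inv_of_pos (by positivity), ← ENNReal.ofReal_inv_of_pos (by positivity),
      ← ENNReal.ofReal_sub _ (by positivity)]
    congr 1
    rw [Real.rpow_neg hn.le]
    field_simp
    ring

/-- The integral which gives the Laplace transform of the interference. -/
lemma lintegral_one_sub_inv_one_add_pathLoss {α s : ℝ} (hα : 2 < α) (hs : 0 < s) (z : Plane) :
    ∫⁻ x, (1 - (1 + ENNReal.ofReal s * pathLoss α x z)⁻¹) =
      ENNReal.ofReal (Real.pi * s ^ (2 / α) *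
        (Real.sin (Real.pi * (2 / α)) / (2 / α * Real.pi))⁻¹) := by
  have hα0 : 0 < α := by linarith
  have hd0 : 0 < 2 / α := by positivity
  have hd1 : 2 / α < 1 := by rw [div_lt_one hα0]; exact hα
  have := isProbabilityMeasure_expMeasure one_pos
  have htr : ∀ x, pathLoss α x z = pathLoss α (x - z) 0 := fun x => by
    simp [pathLoss, dist_eq_norm]
  simp_rw [htr]
  rw [lintegral_sub_right_eq_self (fun x => 1 - (1 + ENNReal.ofReal s * pathLoss α x 0)⁻¹) z]
  -- With the reciprocal written as `E exp (-c w)`, `w` exponential, and the integrals exchanged,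
  -- the plane integral is `π s ^ δ Γ (δ + 1) w ^ (-δ)` and the mean over `w` adds `Γ (1 - δ)`.
  simp_rw [one_sub_inv_one_add_pathLoss hα0 hs, ← lintegral_expNeg_expMeasure]
  rw [lintegral_lintegral_swap (by
    refine Measurable.aemeasurable ?_
    unfold Function.uncurry
    fun_prop)]
  have hinner : ∀ᵐ w ∂(expMeasure 1),
      ∫⁻ x : Plane, expNeg (ENNReal.ofReal (s⁻¹ * ‖x‖ ^ α) * ENNReal.ofReal w) =
        ENNReal.ofReal (Real.pi * s ^ (2 / α) * Real.Gamma (2 / α + 1)) *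
          ENNReal.ofReal (w ^ (-(2 / α))) := by
    filter_upwards [ae_expMeasure_one_pos] with w hw
    have : ∀ x : Plane, expNeg (ENNReal.ofReal (s⁻¹ * ‖x‖ ^ α) * ENNReal.ofReal w) =
        ENNReal.ofReal (Real.exp (-(w / s) * ‖x‖ ^ α)) := fun x => by
      rw [← ENNReal.ofReal_mul (by positivity), expNeg_ofReal (by positivity)]
      congr 2
      field_simp
    simp_rw [this]
    rw [lintegral_plane_exp_neg_mul_rpow (by linarith) (by positivity),
      ← ENNReal.ofReal_mul
        (mul_nonneg (by positivity) (Real.Gamma_pos_of_pos (by positivity)).le)]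
    congr 1
    rw [Real.div_rpow hw.le hs.le, neg_div, Real.rpow_neg hs.le]
    field_simp
  rw [lintegral_congr_ae hinner, lintegral_const_mul' _ _ ENNReal.ofReal_ne_top,
    lintegral_rpow_neg_expMeasure hd1, ← ENNReal.ofReal_mul
      (mul_nonneg (by positivity) (Real.Gamma_pos_of_pos (by positivity)).le)]
  congr 1
  -- The reflection formula turns `δ Γ(δ) Γ(1 - δ)` into `ξ⁻¹`.
  rw [Real.Gamma_add_one hd0.ne', inv_div]
  have := Real.Gamma_mul_Gamma_one_sub (2 / α)
  calc _ = Real.pi * s ^ (2 / α) * (2 / α) *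
        (Real.Gamma (2 / α) * Real.Gamma (1 - 2 / α)) := by ring
    _ = _ := by rw [this]; ring

end PathLoss

section Interference

variable {Ω ι κ : Type*} [MeasurableSpace Ω] [Countable ι] {P : Measure Ω} [IsProbabilityMeasure P]
  {X : ι → Ω → Plane} {act : ι → Set Ω} {f : ι → κ → Ω → ℝ} {lam p : ℝ}

/-- The Laplace transform of the interference. -/
theorem IsThinnedFadedHPPP.laplace_interference (h : IsThinnedFadedHPPP P X act f lam p) (j : κ)
    {α s : ℝ} (hα : 2 < α) (hs : 0 < s) (hlam : 0 ≤ lam) (hp : 0 ≤ p) (z : Plane) :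
    ∫⁻ ω, expNeg (ENNReal.ofReal s * interference α X act f j z ω) ∂P =
      ENNReal.ofReal (Real.exp (-(Real.pi * s ^ (2 / α) *
        (Real.sin (Real.pi * (2 / α)) / (2 / α * Real.pi))⁻¹ * (p * lam)))) := by
  have hg : Measurable fun x => ENNReal.ofReal s * pathLoss α x z :=
    ((measurable_pathLoss α).comp (measurable_id.prodMk measurable_const)).const_mul _
  have e : ∀ ω, ENNReal.ofReal s * interference α X act f j z ω =
      ∑' u, ENNReal.ofReal s * pathLoss α (X u ω) z * activeFading act f j u ω := by
    intro ω
    rw [interference, ← ENNReal.tsum_mul_left]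
    refine tsum_congr fun u => ?_
    by_cases hu : ω ∈ act u
    · simp only [activeFading, hu, Set.indicator_of_mem]
      ring
    · simp [activeFading, hu]
  simp_rw [e]
  have hα0 : 0 < α := by linarith
  have hsin : 0 < Real.sin (Real.pi * (2 / α)) := by
    refine Real.sin_pos_of_pos_of_lt_pi (by positivity) ?_
    have : 2 / α < 1 := by rw [div_lt_one hα0]; exact hα
    nlinarith [Real.pi_pos]
  rw [h.laplace_functional j hg, lintegral_one_sub_inv_one_add_pathLoss hα hs,
    ← ENNReal.ofReal_mul hlam, ← ENNReal.ofReal_mul (by positivity), expNeg_ofReal (by positivity)]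
  congr 3
  ring

end Interference

/-! ### Integrals depending measurably on a random measure. -/

section RandomMeasure

variable {E β : Type*} [MeasurableSpace E] [MeasurableSpace β]

/-- Normalized restriction of a measure to `A`, as a kernel from the space of measures. -/
noncomputable def restrictKernel {A : Set E} (hA : MeasurableSet A) : Kernel (Measure E) E where
  toFun μ := (μ A)⁻¹ • μ.restrict A
  measurable' := by
    refine Measure.measurable_of_measurable_coe _ fun s hs => ?_
    simp only [Measure.smul_apply, smul_eq_mul, Measure.restrict_apply hs]
    exact (Measure.measurable_coe hA).inv.mul (Measure.measurable_coe (hs.inter hA))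

/-- This bound is the purpose of the normalization: for a finite kernel, integrals of jointly
measurable functions are measurable in the parameter and the measure. The factor `μ A` restores the
integral afterwards if it is finite. -/
instance {A : Set E} (hA : MeasurableSet A) : IsFiniteKernel (restrictKernel hA) := by
  refine ⟨1, ENNReal.one_lt_top, fun μ => ?_⟩
  change (μ A)⁻¹ * μ.restrict A Set.univ ≤ 1
  rw [Measure.restrict_apply_univ]
  exact ENNReal.inv_mul_le_one _

lemma measurable_setLIntegral_restrictKernel {A : Set E} (hA : MeasurableSet A)
    {g : β → E → ℝ≥0∞} (hg : Measurable fun q : β × E => g q.1 q.2) :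
    Measurable fun y : β × Measure E => y.2 A * ∫⁻ x, g y.1 x ∂(restrictKernel hA y.2) := by
  refine ((Measure.measurable_coe hA).comp measurable_snd).mul ?_
  have : Measurable (Function.uncurry fun (y : β × Measure E) (x : E) => g y.1 x) :=
    hg.comp ((measurable_fst.comp measurable_fst).prodMk measurable_snd)
  exact this.lintegral_kernel_prod_right (κ := (restrictKernel hA).comap Prod.snd measurable_snd)

lemma setLIntegral_eq_restrictKernel {A : Set E} (hA : MeasurableSet A) (g : E → ℝ≥0∞)
    {μ : Measure E} (hμ : μ A ≠ ∞) :
    μ A * ∫⁻ x, g x ∂(restrictKernel hA μ) = ∫⁻ x in A, g x ∂μ := by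
  change μ A * ∫⁻ x, g x ∂((μ A)⁻¹ • μ.restrict A) = _
  rw [lintegral_smul_measure, smul_eq_mul]
  rcases eq_or_ne (μ A) 0 with h0 | h0
  · rw [h0, zero_mul, Measure.restrict_eq_zero.2 h0, lintegral_zero_measure]
  · rw [← mul_assoc, ENNReal.mul_inv_cancel h0 hμ, one_mul]

/-- The integral with respect to a measure that is finite on the sets of a countable partition, in
a form that depends measurably on the measure. -/
lemma measurable_tsum_restrictKernel {A : ℕ → Set E} (hA : ∀ n, MeasurableSet (A n))
    {g : β → E → ℝ≥0∞} (hg : Measurable fun q : β × E => g q.1 q.2) :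
    Measurable fun y : β × Measure E =>
      ∑' n, y.2 (A n) * ∫⁻ x, g y.1 x ∂(restrictKernel (hA n) y.2) :=
  Measurable.tsum fun n => measurable_setLIntegral_restrictKernel (hA n) hg

lemma tsum_restrictKernel {A : ℕ → Set E} (hA : ∀ n, MeasurableSet (A n))
    (hd : Pairwise (Function.onFun Disjoint A)) (hU : ⋃ n, A n = Set.univ) (g : E → ℝ≥0∞)
    {μ : Measure E} (hμ : ∀ n, μ (A n) ≠ ∞) :
    ∑' n, μ (A n) * ∫⁻ x, g x ∂(restrictKernel (hA n) μ) = ∫⁻ x, g x ∂μ := by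
  simp_rw [setLIntegral_eq_restrictKernel (hA _) g (hμ _)]
  rw [← lintegral_iUnion hA hd, hU, setLIntegral_univ]

end RandomMeasure

/-! ### The interference as a function of the thinned process. -/

section Thinned

variable {Ω ι κ : Type*}

/-- The marked points whose distance to the origin has integer part `n`. -/
def shell (κ : Type*) (n : ℕ) : Set (Plane × (κ → ℝ)) := {y | ⌊‖y.1‖⌋₊ = n}

lemma measurableSet_shell (n : ℕ) : MeasurableSet (shell κ n) :=
  (Nat.measurable_floor.comp measurable_fst.norm) (measurableSet_singleton n)

/-- The interference at the receiver `j` located at `z`, as a function of the thinned process. -/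
noncomputable def interferenceOf (α : ℝ) (j : κ) (y : Plane × Measure (Plane × (κ → ℝ))) : ℝ≥0∞ :=
  ∑' n, y.2 (shell κ n) *
    ∫⁻ x, ENNReal.ofReal (x.2 j) * pathLoss α x.1 y.1 ∂(restrictKernel (measurableSet_shell n) y.2)

lemma measurable_faded_pathLoss (α : ℝ) (j : κ) :
    Measurable fun q : Plane × (Plane × (κ → ℝ)) =>
      ENNReal.ofReal (q.2.2 j) * pathLoss α q.2.1 q.1 := by
  unfold pathLoss
  fun_prop

@[fun_prop]
lemma measurable_interferenceOf (α : ℝ) (j : κ) : Measurable (interferenceOf α j) :=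
  measurable_tsum_restrictKernel measurableSet_shell
    (g := fun z x => ENNReal.ofReal (x.2 j) * pathLoss α x.1 z) (measurable_faded_pathLoss α j)

lemma lintegral_thinned (X : ι → Ω → Plane) (act : ι → Set Ω) (f : ι → κ → Ω → ℝ) (ω : Ω)
    {g : Plane × (κ → ℝ) → ℝ≥0∞} (hg : Measurable g) :
    ∫⁻ x, g x ∂(thinned X act f ω) =
      ∑' u, (act u).indicator (fun ω => g (X u ω, fun j => f u j ω)) ω := by
  rw [thinned, lintegral_sum_measure]
  refine tsum_congr fun u => ?_
  by_cases hu : ω ∈ act u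
  · simp [hu, lintegral_dirac' _ hg]
  · simp [hu]

variable [MeasurableSpace Ω] [Countable ι] {P : Measure Ω}
  {X : ι → Ω → Plane} {act : ι → Set Ω} {f : ι → κ → Ω → ℝ} {lam p : ℝ}

lemma IsThinnedFadedHPPP.measurable_thinned (h : IsThinnedFadedHPPP P X act f lam p) :
    Measurable (thinned X act f) := by
  refine Measure.measurable_of_measurable_coe _ fun s hs => ?_
  simp_rw [← lintegral_indicator_one hs]
  have hm : Measurable (s.indicator (1 : Plane × (κ → ℝ) → ℝ≥0∞)) := measurable_one.indicator hs
  simp_rw [lintegral_thinned X act f _ hm]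
  refine Measurable.tsum fun u => Measurable.indicator (hm.comp ?_) (h.measurableSet_act u)
  exact (h.hppp.measurable_point u).prodMk (measurable_pi_lambda _ (h.measurable_fading u))

variable [IsProbabilityMeasure P]

lemma IsHPPP.ae_pointCount_ne_top (h : IsHPPP P X lam) {A : Set Plane} (hA : MeasurableSet A)
    (hb : Bornology.IsBounded A) : ∀ᵐ ω ∂P, pointCount X A ω ≠ ⊤ := by
  have h1 : P.map (pointCount X A) {⊤} = 0 := by
    rw [h.map_pointCount hA hb, Measure.map_apply measurable_from_top .of_discrete]
    convert! measure_empty (μ := poissonMeasure _)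
    ext n; simp
  rw [Measure.map_apply (h.measurable_pointCount hA) .of_discrete] at h1
  exact measure_eq_zero_iff_ae_notMem.1 h1

/-- The formula over shells is exact as soon as every shell has finite mass, which holds almost
surely. The null set serves all `j` and `z` at once, so a random station location may be inserted
for `z`. -/
lemma IsThinnedFadedHPPP.ae_interferenceOf_thinned (h : IsThinnedFadedHPPP P X act f lam p)
    (α : ℝ) : ∀ᵐ ω ∂P, ∀ j z,
      interferenceOf α j (z, thinned X act f ω) = interference α X act f j z ω := by
  have hfin : ∀ᵐ ω ∂P, ∀ n : ℕ, pointCount X (Metric.ball 0 (n + 1)) ω ≠ ⊤ :=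
    ae_all_iff.2 fun n => h.hppp.ae_pointCount_ne_top Metric.isOpen_ball.measurableSet
      Metric.isBounded_ball
  filter_upwards [hfin] with ω hω j z
  have hm : Measurable fun x : Plane × (κ → ℝ) => ENNReal.ofReal (x.2 j) * pathLoss α x.1 z :=
    (measurable_faded_pathLoss α j).comp (measurable_const.prodMk measurable_id)
  rw [interference, ← lintegral_thinned X act f ω hm]
  refine tsum_restrictKernel measurableSet_shell ?_ ?_ _ fun n => ?_
  · exact fun n m hnm => Set.disjoint_left.2 fun x hx hx' => hnm (hx.symm.trans hx')
  · exact Set.eq_univ_of_forall fun x => Set.mem_iUnion.2 ⟨_, rfl⟩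
  -- A norm with integer part `n` is below `n + 1`, and deleting points only lowers the count.
  · have hle : thinned X act f ω (shell κ n) ≤ pointMeasure X ω (Metric.ball 0 (n + 1)) := by
      have hS := measurableSet_shell (κ := κ) n
      have hB : MeasurableSet (Metric.ball (0 : Plane) (n + 1)) := Metric.isOpen_ball.measurableSet
      rw [← lintegral_indicator_one hS, ← lintegral_indicator_one hB,
        lintegral_thinned X act f ω (measurable_one.indicator hS),
        lintegral_pointMeasure X ω (measurable_one.indicator hB)]
      refine ENNReal.tsum_le_tsum fun u => ?_
      refine (Set.indicator_le_self' (fun _ _ => zero_le) ω).trans ?_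
      by_cases hx : (X u ω, fun j => f u j ω) ∈ shell κ n
      · have hx' : ⌊‖X u ω‖⌋₊ = n := hx
        have : X u ω ∈ Metric.ball (0 : Plane) (n + 1) := by
          rw [mem_ball_zero_iff, ← hx']
          exact Nat.lt_floor_add_one _
        simp [hx, this]
      · simp [hx]
    refine (hle.trans_lt ?_).ne
    rw [pointMeasure_apply X ω Metric.isOpen_ball.measurableSet]
    exact_mod_cast (hω n).lt_top

end Thinned

/-! ### The nearest base station. -/

section Nearest

variable {Ω κ : Type*} {X : κ → Ω → Plane} {lam : ℝ}

lemma expMeasure_one_Ici (t : ℝ) :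
    expMeasure 1 (Set.Ici t) = ENNReal.ofReal (Real.exp (-max t 0)) := by
  have := isProbabilityMeasure_expMeasure one_pos
  have : NullSingletonClass (expMeasure 1) :=
    ⟨fun x => withDensity_absolutelyContinuous _ _ (by simp)⟩
  have h := cdf_expMeasure_eq one_pos t
  rw [cdf_eq_real] at h
  rw [← measure_congr (Ioi_ae_eq_Ici (μ := expMeasure 1)), ← Set.compl_Iic,
    prob_compl_eq_one_sub measurableSet_Iic, ← ofReal_measureReal, h]
  split_ifs with ht
  · have : Real.exp (-t) ≤ 1 := by simpa using ht
    rw [max_eq_left ht, one_mul, ← ENNReal.ofReal_one, ← ENNReal.ofReal_sub _ (by linarith),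
      sub_sub_cancel]
  · simp [max_eq_right (not_le.1 ht).le]

/-- In the coordinate `π lam ‖x‖ ^ 2` the mean number of points below `t` is `t` itself. -/
lemma volume_norm_lt {lam t : ℝ} (hlam : 0 < lam) (ht : 0 ≤ t) :
    volume {x : Plane | Real.pi * lam * ‖x‖ ^ 2 < t} = ENNReal.ofReal (t / lam) := by
  have hpl : 0 < Real.pi * lam := mul_pos Real.pi_pos hlam
  have e : {x : Plane | Real.pi * lam * ‖x‖ ^ 2 < t} =
      Metric.ball 0 (Real.sqrt (t / (Real.pi * lam))) := by
    ext x
    simp only [Metric.mem_ball, dist_zero_right, Set.mem_ofPred_eq]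
    rw [Real.lt_sqrt (norm_nonneg x), lt_div_iff₀ hpl, mul_comm]
  rw [e, EuclideanSpace.volume_ball_fin_two, ← ENNReal.ofReal_pow (Real.sqrt_nonneg _),
    Real.sq_sqrt (by positivity), ← ENNReal.ofReal_mul (by positivity)]
  congr 1
  field_simp

lemma measurableSet_norm_lt (lam t : ℝ) :
    MeasurableSet {x : Plane | Real.pi * lam * ‖x‖ ^ 2 < t} :=
  measurableSet_lt (by fun_prop) measurable_const

lemma isBounded_norm_lt {lam : ℝ} (hlam : 0 < lam) (t : ℝ) :
    Bornology.IsBounded {x : Plane | Real.pi * lam * ‖x‖ ^ 2 < t} := by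
  have hpl : 0 < Real.pi * lam := mul_pos Real.pi_pos hlam
  -- The radius comes from `r ≤ 1 + r ^ 2`, which avoids square roots.
  refine (Metric.isBounded_closedBall (x := (0 : Plane)) (r := 1 + t / (Real.pi * lam))).subset
    fun x hx => ?_
  have hx' : Real.pi * lam * ‖x‖ ^ 2 < t := hx
  rw [mul_comm, ← lt_div_iff₀ hpl] at hx'
  rw [mem_closedBall_zero_iff]
  nlinarith [sq_nonneg (‖x‖ - 1), norm_nonneg x]

/-- The configurations whose unique nearest point to the origin is the point `j`. -/
def uniqueNearest (j : κ) : Set (κ → Plane) := {x | ∀ j', j' ≠ j → ‖x j‖ < ‖x j'‖}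

lemma pairwise_disjoint_uniqueNearest :
    Pairwise (Function.onFun Disjoint (uniqueNearest (κ := κ))) := fun j j' hjj' =>
  Set.disjoint_left.2 fun _ hx hx' => lt_asymm (hx j' hjj'.symm) (hx' j hjj')

variable [MeasurableSpace Ω] {P : Measure Ω}

/-- The void probabilities of a homogeneous Poisson point process. -/
lemma IsHPPP.measure_forall_le_norm (h : IsHPPP P X lam) (hlam : 0 < lam) {t : ℝ} (ht : 0 ≤ t) :
    P {ω | ∀ j, t ≤ Real.pi * lam * ‖X j ω‖ ^ 2} = ENNReal.ofReal (Real.exp (-t)) := by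
  have h0 := h.poisson_count _ (measurableSet_norm_lt lam t) (isBounded_norm_lt hlam t) 0
  have e : {ω | pointCount X {x : Plane | Real.pi * lam * ‖x‖ ^ 2 < t} ω = ((0 : ℕ) : ℕ∞)} =
      {ω | ∀ j, t ≤ Real.pi * lam * ‖X j ω‖ ^ 2} := by
    ext ω
    simp [pointCount, Set.eq_empty_iff_forall_notMem]
  rw [e, volume_norm_lt hlam ht, poissonMeasure_singleton] at h0
  rw [h0, ENNReal.toReal_ofReal (by positivity), mul_div_cancel₀ _ hlam.ne',
    Real.coe_toNNReal _ ht]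
  simp

variable [Countable κ] [IsProbabilityMeasure P]

/-- From `exp (-x) ≥ 1 - x`: `1 - (1 + x) exp (-x) ≤ x ^ 2`. The second order matters when many
small sets are summed. -/
lemma IsHPPP.measure_pointCount_ne_le (h : IsHPPP P X lam) (hlam : 0 ≤ lam)
    {A : Set Plane} (hA : MeasurableSet A) (hb : Bornology.IsBounded A) :
    P {ω | pointCount X A ω ≠ 0 ∧ pointCount X A ω ≠ 1} ≤
      ENNReal.ofReal ((lam * (volume A).toReal) ^ 2) := by
  set x := lam * (volume A).toReal
  have hx : 0 ≤ x := by positivity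
  have hm := h.measurable_pointCount hA
  have h0 := h.poisson_count A hA hb 0
  have h1 := h.poisson_count A hA hb 1
  rw [poissonMeasure_singleton, Real.coe_toNNReal _ hx] at h0 h1
  have hm0 : MeasurableSet {ω | pointCount X A ω = ((0 : ℕ) : ℕ∞)} :=
    hm (measurableSet_singleton _)
  have hm1 : MeasurableSet {ω | pointCount X A ω = ((1 : ℕ) : ℕ∞)} :=
    hm (measurableSet_singleton _)
  have hd : Disjoint {ω | pointCount X A ω = ((0 : ℕ) : ℕ∞)}
      {ω | pointCount X A ω = ((1 : ℕ) : ℕ∞)} :=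
    Set.disjoint_left.2 fun ω h h' => by
      have := (show _ = _ from h).symm.trans h'
      simp at this
  have e : {ω | pointCount X A ω ≠ 0 ∧ pointCount X A ω ≠ 1} =
      ({ω | pointCount X A ω = ((0 : ℕ) : ℕ∞)} ∪ {ω | pointCount X A ω = ((1 : ℕ) : ℕ∞)})ᶜ := by
    ext ω; simp
  rw [e, prob_compl_eq_one_sub (hm0.union hm1), measure_union hd hm1, h0, h1,
    ← ENNReal.ofReal_add (by positivity) (by positivity), ← ENNReal.ofReal_one,
    ← ENNReal.ofReal_sub _ (by positivity)]
  refine ENNReal.ofReal_le_ofReal ?_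
  have := Real.add_one_le_exp (-x)
  simp only [pow_zero, pow_one, Nat.factorial_zero, Nat.factorial_one, Nat.cast_one]
  nlinarith

/-- Cut a disc of mean count `K` into `K (n + 1)` annuli of mean count `1 / (n + 1)`. Points at
equal distance share an annulus, which for a given annulus has probability at most `1 / (n + 1) ^
2`; the union bound `K / (n + 1)` tends to `0`. -/
lemma IsHPPP.ae_norm_ne (h : IsHPPP P X lam) (hlam : 0 < lam) :
    ∀ᵐ ω ∂P, ∀ j j', j ≠ j' → ‖X j ω‖ ≠ ‖X j' ω‖ := by
  have hK : ∀ K : ℕ, ∀ᵐ ω ∂P, ¬ ∃ j j', j ≠ j' ∧ ‖X j ω‖ = ‖X j' ω‖ ∧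
      Real.pi * lam * ‖X j ω‖ ^ 2 < K := by
    intro K
    have hbound : ∀ n : ℕ, P {ω | ∃ j j', j ≠ j' ∧ ‖X j ω‖ = ‖X j' ω‖ ∧
        Real.pi * lam * ‖X j ω‖ ^ 2 < K} ≤ ENNReal.ofReal (K * (1 / ((n : ℝ) + 1))) := by
      intro n
      set B : ℕ → Set Plane := fun k =>
        {x | Real.pi * lam * ‖x‖ ^ 2 < (k + 1) / (n + 1)} \
          {x | Real.pi * lam * ‖x‖ ^ 2 < k / (n + 1)}
      have hBm : ∀ k, MeasurableSet (B k) := fun k =>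
        (measurableSet_norm_lt _ _).diff (measurableSet_norm_lt _ _)
      have hBb : ∀ k, Bornology.IsBounded (B k) := fun k =>
        (isBounded_norm_lt hlam _).subset Set.sdiff_subset
      have hBv : ∀ k, lam * (volume (B k)).toReal = 1 / (n + 1) := by
        intro k
        have hn : (0 : ℝ) < n + 1 := by positivity
        rw [measure_sdiff _ (measurableSet_norm_lt _ _).nullMeasurableSet,
          volume_norm_lt hlam (by positivity), volume_norm_lt hlam (by positivity),
          ← ENNReal.ofReal_sub _ (by positivity), ENNReal.toReal_ofReal]
        · field_simp
          ring
        · rw [← sub_div, ← sub_div]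
          ring_nf
          positivity
        · rw [volume_norm_lt hlam (by positivity)]
          exact ENNReal.ofReal_ne_top
        · intro x hx
          refine (show Real.pi * lam * ‖x‖ ^ 2 < _ from hx).trans ?_
          gcongr
          simp
      have hsub : {ω | ∃ j j', j ≠ j' ∧ ‖X j ω‖ = ‖X j' ω‖ ∧ Real.pi * lam * ‖X j ω‖ ^ 2 < K} ⊆
          ⋃ k ∈ Finset.range (K * (n + 1)),
            {ω | pointCount X (B k) ω ≠ 0 ∧ pointCount X (B k) ω ≠ 1} := by
        rintro ω ⟨j, j', hjj', hn, hlt⟩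
        have hn' : (0 : ℝ) < n + 1 := by positivity
        set y := Real.pi * lam * ‖X j ω‖ ^ 2 with hy
        have hy0 : 0 ≤ y := by positivity
        have hmem : ∀ i, ‖X i ω‖ = ‖X j ω‖ → X i ω ∈ B ⌊y * (n + 1)⌋₊ := by
          intro i hi
          have h1 := Nat.lt_floor_add_one (y * (n + 1))
          have h2 := Nat.floor_le (a := y * (n + 1)) (by positivity)
          refine ⟨?_, ?_⟩
          · change Real.pi * lam * ‖X i ω‖ ^ 2 < _
            rwa [hi, ← hy, lt_div_iff₀ hn']
          · change ¬ (Real.pi * lam * ‖X i ω‖ ^ 2 < _)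
            rwa [hi, ← hy, not_lt, div_le_iff₀ hn']
        refine Set.mem_biUnion (x := ⌊y * (n + 1)⌋₊) ?_ ?_
        · simp only [Finset.coe_range, Set.mem_Iio]
          rw [Nat.floor_lt (by positivity)]
          push_cast
          exact mul_lt_mul_of_pos_right hlt hn'
        · have h2 : 1 < pointCount X (B ⌊y * (n + 1)⌋₊) ω :=
            Set.one_lt_encard_iff.2 ⟨j, j', hmem j rfl, hmem j' hn.symm, hjj'⟩
          exact ⟨(zero_lt_one.trans h2).ne', h2.ne'⟩
      refine (measure_mono hsub).trans ((measure_biUnion_finset_le _ _).trans ?_)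
      refine (Finset.sum_le_sum fun k _ =>
        h.measure_pointCount_ne_le hlam.le (hBm k) (hBb k)).trans ?_
      simp_rw [hBv]
      rw [Finset.sum_const, Finset.card_range, nsmul_eq_mul, ← ENNReal.ofReal_natCast,
        ← ENNReal.ofReal_mul (by positivity)]
      refine ENNReal.ofReal_le_ofReal (le_of_eq ?_)
      push_cast
      field_simp
    have hlim : Tendsto (fun n : ℕ => ENNReal.ofReal (K * (1 / ((n : ℝ) + 1)))) atTop (𝓝 0) := by
      have := (tendsto_one_div_add_atTop_nhds_zero_nat (𝕜 := ℝ)).const_mul (K : ℝ)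
      simpa using ENNReal.tendsto_ofReal this
    refine measure_eq_zero_iff_ae_notMem.1 (le_antisymm ?_ zero_le)
    exact ge_of_tendsto' hlim hbound
  filter_upwards [ae_all_iff.2 hK] with ω hω j j' hjj' hn
  obtain ⟨K, hK⟩ := exists_nat_gt (Real.pi * lam * ‖X j ω‖ ^ 2)
  exact hω K ⟨j, j', hjj', hn, hK⟩

lemma IsHPPP.ae_exists_nearest (h : IsHPPP P X lam) (hlam : 0 < lam) :
    ∀ᵐ ω ∂P, ∃ j, ∀ j', ‖X j ω‖ ≤ ‖X j' ω‖ := by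
  -- Without any point the unit void probability would be `1` rather than `exp (-1)`.
  have hne : Nonempty κ := by
    by_contra hκ
    have : IsEmpty κ := not_nonempty_iff.1 hκ
    have := h.measure_forall_le_norm hlam zero_le_one
    have h1 : ENNReal.ofReal (Real.exp (-1)) < 1 := ENNReal.ofReal_lt_one.2 (by simp)
    simp [← this] at h1
  have hfin : ∀ᵐ ω ∂P, ∀ n : ℕ, pointCount X (Metric.ball 0 n) ω ≠ ⊤ :=
    ae_all_iff.2 fun n => h.ae_pointCount_ne_top Metric.isOpen_ball.measurableSet
      Metric.isBounded_ball
  filter_upwards [hfin] with ω hω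
  obtain ⟨j₀⟩ := hne
  obtain ⟨n, hn⟩ := exists_nat_gt ‖X j₀ ω‖
  have hf : {j | X j ω ∈ Metric.ball (0 : Plane) n}.Finite := Set.encard_ne_top_iff.1 (hω n)
  obtain ⟨j, hj, hmin⟩ := Set.exists_min_image _ (fun j => ‖X j ω‖) hf ⟨j₀, by simpa using hn⟩
  refine ⟨j, fun j' => ?_⟩
  by_cases hj' : X j' ω ∈ Metric.ball (0 : Plane) n
  · exact hmin j' hj'
  · have h1 : ‖X j ω‖ < n := by simpa using hj
    have h2 : (n : ℝ) ≤ ‖X j' ω‖ := by simpa using hj'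
    exact h1.le.trans h2

lemma measurableSet_uniqueNearest (j : κ) : MeasurableSet (uniqueNearest j) := by
  have : uniqueNearest j = ⋂ j', ⋂ (_ : j' ≠ j), {x : κ → Plane | ‖x j‖ < ‖x j'‖} := by
    ext x; simp [uniqueNearest]
  rw [this]
  refine MeasurableSet.iInter fun j' => MeasurableSet.iInter fun _ => ?_
  exact measurableSet_lt (by fun_prop) (by fun_prop)

lemma IsHPPP.ae_nearest (h : IsHPPP P X lam) (hlam : 0 < lam) :
    ∀ᵐ ω ∂P, ∃ j, (fun i => X i ω) ∈ uniqueNearest j ∧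
      ∀ i, (∀ i', ‖X i ω‖ ≤ ‖X i' ω‖) ↔ i = j := by
  filter_upwards [h.ae_norm_ne hlam, h.ae_exists_nearest hlam] with ω h1 ⟨j, hj⟩
  refine ⟨j, fun j' hj' => (hj j').lt_of_ne (h1 j j' hj'.symm), fun i => ⟨fun hi => ?_, ?_⟩⟩
  · by_contra hij
    exact h1 i j hij (le_antisymm (hi j) (hj i))
  · rintro rfl
    exact hj

/-- The area, in units of the mean area per point, of the disc reaching up to the nearest point is
exponentially distributed. -/
lemma IsHPPP.lintegral_nearest (h : IsHPPP P X lam) (hlam : 0 < lam) {G : ℝ → ℝ≥0∞}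
    (hG : Measurable G) :
    ∑' j, ∫⁻ ω in (fun ω i => X i ω) ⁻¹' uniqueNearest j, G (Real.pi * lam * ‖X j ω‖ ^ 2) ∂P =
      ∫⁻ t, G t ∂(expMeasure 1) := by
  have hX := h.measurable_point
  have hXm : Measurable fun ω i => X i ω := measurable_pi_lambda _ hX
  have hA : ∀ j, MeasurableSet ((fun ω i => X i ω) ⁻¹' uniqueNearest j) := fun j =>
    hXm (measurableSet_uniqueNearest j)
  have hT : ∀ j, Measurable fun ω => Real.pi * lam * ‖X j ω‖ ^ 2 := fun j =>
    ((hX j).norm.pow_const 2).const_mul _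
  have := isProbabilityMeasure_expMeasure one_pos
  -- Each index contributes the law of its coordinate on the event that it is nearest. On `[t, ∞)`
  -- the contributions add up to the probability that no point lies below `t`.
  have hν : expMeasure 1 = Measure.sum fun j =>
      (P.restrict ((fun ω i => X i ω) ⁻¹' uniqueNearest j)).map
        fun ω => Real.pi * lam * ‖X j ω‖ ^ 2 := by
    refine Measure.ext_of_Ici _ _ fun t => ?_
    rw [Measure.sum_apply _ measurableSet_Ici]
    have e : ∀ j, (P.restrict ((fun ω i => X i ω) ⁻¹' uniqueNearest j)).map
        (fun ω => Real.pi * lam * ‖X j ω‖ ^ 2) (Set.Ici t) =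
        P ({ω | t ≤ Real.pi * lam * ‖X j ω‖ ^ 2} ∩ (fun ω i => X i ω) ⁻¹' uniqueNearest j) := by
      intro j
      rw [Measure.map_apply (hT j) measurableSet_Ici,
        Measure.restrict_apply (hT j measurableSet_Ici)]
      rfl
    simp_rw [e]
    rw [← measure_iUnion]
    · have hae : (⋃ j, {ω | t ≤ Real.pi * lam * ‖X j ω‖ ^ 2} ∩
          (fun ω i => X i ω) ⁻¹' uniqueNearest j : Set Ω) =ᵐ[P]
          -- Negative `t` are truncated because the void probability is for `t ≥ 0`.
          {ω | ∀ j, max t 0 ≤ Real.pi * lam * ‖X j ω‖ ^ 2} := by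
        filter_upwards [h.ae_nearest hlam] with ω ⟨j, hj, _⟩
        refine propext ⟨fun hω => ?_, fun hω => ?_⟩
        · obtain ⟨i, hi, hi'⟩ := Set.mem_iUnion.1 hω
          intro j'
          have hle : ‖X i ω‖ ≤ ‖X j' ω‖ := by
            rcases eq_or_ne j' i with rfl | hne
            · exact le_rfl
            · exact (hi' j' hne).le
          refine max_le ((show t ≤ _ from hi).trans ?_) (by positivity)
          gcongr
        · exact Set.mem_iUnion.2 ⟨j, (le_max_left _ _).trans (hω j), hj⟩
      rw [measure_congr hae, h.measure_forall_le_norm hlam (le_max_right _ _), expMeasure_one_Ici]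
    · exact fun j j' hjj' => ((pairwise_disjoint_uniqueNearest hjj').preimage
        (fun ω i => X i ω)).mono Set.inter_subset_right Set.inter_subset_right
    · exact fun j => (hT j measurableSet_Ici).inter (hA j)
  rw [hν, lintegral_sum_measure]
  exact tsum_congr fun j => (lintegral_map hG (hT j)).symm

end Nearest

/-! ### Decoding at a base station with fixed location. -/

namespace Params

variable (p : Params)

lemma α_pos : 0 < p.α := by linarith [p.two_lt_α]

lemma PIHat_pos : 0 < p.PIHat :=
  div_pos (mul_pos p.PI_pos (div_pos p.b_pos p.BI_pos)) p.PIoT_pos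

lemma probIoT_nonneg : 0 ≤ p.probIoT := by
  have h1 : 0 ≤ p.betaT := zero_le_one.trans p.betaT_mem.1
  have h2 : 0 ≤ p.betaF := zero_le_one.trans p.betaF_mem.1
  have := p.t_pos; have := p.T_pos; have := p.b_pos; have := p.B_pos
  unfold probIoT lamT
  positivity

lemma probI_nonneg : 0 ≤ p.probI := by
  have := p.BI_pos; have := p.B_pos
  unfold probI
  positivity

lemma ξ_pos : 0 < p.ξ := by
  have := p.α_pos
  have hδ : 0 < p.δ := by unfold δ; positivity
  have hδ1 : p.δ < 1 := by unfold δ; rw [div_lt_one p.α_pos]; exact p.two_lt_α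
  refine div_pos (Real.sin_pos_of_pos_of_lt_pi (by positivity) ?_) (by positivity)
  nlinarith [Real.pi_pos]

/-- The mean number of interferers that prevent decoding, per unit of the mean number of base
stations. -/
noncomputable def load : ℝ :=
  p.ξ⁻¹ * p.τ ^ p.δ * ((p.lamIoTTilde + p.PIHat ^ p.δ * p.lamITilde) / p.lamB)

lemma lamIoTTilde_eq : p.lamIoTTilde = p.probIoT * p.lamIoT := rfl

lemma lamITilde_eq : p.lamITilde = p.probI * p.lamI := rfl

lemma load_nonneg : 0 ≤ p.load := by
  have := p.ξ_pos; have := p.τ_pos; have := p.PIHat_pos; have := p.lamB_pos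
  have := p.probIoT_nonneg; have := p.probI_nonneg; have := p.lamIoT_nonneg
  have := p.lamI_nonneg
  rw [load, lamIoTTilde_eq, lamITilde_eq]
  positivity

/-- The probability that a single transmission is decoded by a base station, such that the mean
number of base stations closer to the origin is `t`. -/
noncomputable def decodeProb (nHat t : ℝ) : ℝ :=
  Real.exp (-(p.τ * (t / (Real.pi * p.lamB)) ^ (p.α / 2) * nHat + p.load * t))

lemma decodeProb_nonneg (nHat t : ℝ) : 0 ≤ p.decodeProb nHat t := (Real.exp_pos _).le

lemma decodeProb_le_one {nHat t : ℝ} (hn : 0 ≤ nHat) (ht : 0 ≤ t) : p.decodeProb nHat t ≤ 1 := by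
  have := p.load_nonneg; have := p.τ_pos; have := p.lamB_pos
  refine Real.exp_le_one_iff.2 (neg_nonpos.2 ?_)
  positivity

@[fun_prop]
lemma measurable_decodeProb (nHat : ℝ) : Measurable (p.decodeProb nHat) := by
  unfold decodeProb
  fun_prop

end Params

/-- Isolating the gain also works for vanishing or infinite interference; `z ≠ 0` keeps the path
loss finite and positive. -/
lemma lt_mul_pathLoss_div_iff {α τ : ℝ} (hτ : 0 < τ) {z : Plane} (hz : z ≠ 0) (x : ℝ)
    (d : ℝ≥0∞) :
    ENNReal.ofReal τ < ENNReal.ofReal x * pathLoss α 0 z / d ↔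
      ENNReal.ofReal (τ * ‖z‖ ^ α) * d < ENNReal.ofReal x := by
  have hr : 0 < ‖z‖ := norm_pos_iff.2 hz
  have hR : 0 < ‖z‖ ^ α := Real.rpow_pos_of_pos hr α
  have hR0 : ENNReal.ofReal (‖z‖ ^ α) ≠ 0 := by simpa using hR
  have hL : pathLoss α 0 z = (ENNReal.ofReal (‖z‖ ^ α))⁻¹ := by
    rw [pathLoss, dist_zero_left, ENNReal.rpow_neg, ENNReal.ofReal_rpow_of_pos hr]
  rw [hL, ← div_eq_mul_inv, ENNReal.ofReal_mul hτ.le]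
  rcases eq_or_ne d 0 with rfl | hd0
  · rcases le_or_gt x 0 with hx | hx
    · simp [ENNReal.ofReal_of_nonpos hx]
    · have : ENNReal.ofReal x / ENNReal.ofReal (‖z‖ ^ α) ≠ 0 :=
        (ENNReal.div_pos (by simpa using hx) ENNReal.ofReal_ne_top).ne'
      simp [ENNReal.div_zero this, hx]
  rcases eq_or_ne d ∞ with rfl | hd
  · simp [ENNReal.mul_top, hτ, hR]
  rw [ENNReal.lt_div_iff_mul_lt (Or.inl hd0) (Or.inl hd),
    ENNReal.lt_div_iff_mul_lt (Or.inl hR0) (Or.inl ENNReal.ofReal_ne_top), mul_right_comm]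

namespace Network

variable {Ω κ ι ι' : Type*} {p : Params} {W : Network Ω κ ι ι' p.N}

/-- The random elements that decide upon transmission `i` at the base station `j`. -/
noncomputable def transmission (W : Network Ω κ ι ι' p.N) (j : κ) (i : Fin p.N) (ω : Ω) :
    ℝ × Measure (Plane × (κ → ℝ)) × Measure (Plane × (κ → ℝ)) :=
  (W.gain i j ω, thinned (W.iot i) (W.iotActive i) (W.iotFading i) ω,
    thinned (W.inc i) (W.incActive i) (W.incFading i) ω)

/-- Noise plus interference at the base station `j` located at `z`. -/
noncomputable def noiseOf (p : Params) (nHat : ℝ) (j : κ) (z : Plane)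
    (y : Measure (Plane × (κ → ℝ)) × Measure (Plane × (κ → ℝ))) : ℝ≥0∞ :=
  ENNReal.ofReal nHat + interferenceOf p.α j (z, y.1)
    + ENNReal.ofReal p.PIHat * interferenceOf p.α j (z, y.2)

/-- The `SINR` at the base station `j` located at `z`. -/
noncomputable def sinrOf (p : Params) (nHat : ℝ) (j : κ) (z : Plane)
    (y : ℝ × Measure (Plane × (κ → ℝ)) × Measure (Plane × (κ → ℝ))) : ℝ≥0∞ :=
  ENNReal.ofReal y.1 * pathLoss p.α 0 z / noiseOf p nHat j z y.2

lemma measurable_noiseOf (nHat : ℝ) (j : κ) (z : Plane) : Measurable (noiseOf p nHat j z) := by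
  unfold noiseOf
  fun_prop

lemma measurable_sinrOf (nHat : ℝ) (j : κ) :
    Measurable fun q : Plane × (ℝ × Measure (Plane × (κ → ℝ)) × Measure (Plane × (κ → ℝ))) =>
      sinrOf p nHat j q.1 q.2 := by
  unfold sinrOf noiseOf pathLoss
  fun_prop

lemma measurable_transmission_iSup (W : Network Ω κ ι ι' p.N) {S : Set (Source κ p.N)} {j : κ}
    {i : Fin p.N} (h1 : .gain i j ∈ S) (h2 : .iot i ∈ S) (h3 : .inc i ∈ S) :
    Measurable[⨆ s ∈ S, W.sourceSigma s] (W.transmission j i) := by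
  have a1 : W.sourceSigma (.gain i j) ≤ ⨆ s ∈ S, W.sourceSigma s := le_iSup₂_of_le _ h1 le_rfl
  have a2 : W.sourceSigma (.iot i) ≤ ⨆ s ∈ S, W.sourceSigma s := le_iSup₂_of_le _ h2 le_rfl
  have a3 : W.sourceSigma (.inc i) ≤ ⨆ s ∈ S, W.sourceSigma s := le_iSup₂_of_le _ h3 le_rfl
  exact ((comap_measurable _).mono a1 le_rfl).prodMk
    (((comap_measurable _).mono a2 le_rfl).prodMk ((comap_measurable _).mono a3 le_rfl))

variable [MeasurableSpace Ω] {P : Measure Ω}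

namespace IsBenchmarkRandom

lemma indepFun_thinned (hW : W.IsBenchmarkRandom p P) (i : Fin p.N) :
    IndepFun (thinned (W.iot i) (W.iotActive i) (W.iotFading i))
      (thinned (W.inc i) (W.incActive i) (W.incFading i)) P :=
  hW.indep.indep (i := .iot i) (j := .inc i) (by simp)

variable [Countable ι] [Countable ι']

lemma sourceSigma_le (hW : W.IsBenchmarkRandom p P) (s : Source κ p.N) :
    W.sourceSigma s ≤ (inferInstance : MeasurableSpace Ω) := by
  cases s with
  | stations => exact (measurable_pi_lambda _ hW.stations.measurable_point).comap_le
  | gain i j => exact (hW.measurable_gain i j).comap_le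
  | iot i => exact (hW.iot i).measurable_thinned.comap_le
  | inc i => exact (hW.inc i).measurable_thinned.comap_le

lemma measurable_transmission (hW : W.IsBenchmarkRandom p P) (j : κ) (i : Fin p.N) :
    Measurable (W.transmission j i) :=
  (hW.measurable_gain i j).prodMk
    ((hW.iot i).measurable_thinned.prodMk (hW.inc i).measurable_thinned)

lemma indepFun_stations (hW : W.IsBenchmarkRandom p P) (j : κ) :
    IndepFun (fun ω k => W.bs k ω) (fun ω i => W.transmission j i ω) P := by
  have hd : Disjoint ({.stations} : Set (Source κ p.N)) {.stations}ᶜ := disjoint_compl_right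
  have hle : W.sourceSigma .stations ≤
      ⨆ s ∈ ({.stations} : Set (Source κ p.N)), W.sourceSigma s := le_iSup₂_of_le _ rfl le_rfl
  refine indep_of_indep_of_le (indep_iSup_of_disjoint hW.sourceSigma_le hW.indep hd) hle ?_
  refine Measurable.comap_le (@measurable_pi_lambda _ _ _ (_) _ _ fun i => ?_)
  exact measurable_transmission_iSup W (by simp) (by simp) (by simp)

/-- Here random repetition enters: distinct transmissions use disjoint groups of sources. -/
lemma iIndepFun_transmission (hW : W.IsBenchmarkRandom p P) (j : κ) :
    iIndepFun (W.transmission j) P := by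
  have hd : Pairwise (Function.onFun Disjoint
      fun i : Fin p.N => ({.gain i j, .iot i, .inc i} : Set (Source κ p.N))) := by
    intro i i' hii'
    simp [Function.onFun, hii'.symm]
  refine iIndep_of_iIndep_of_le (iIndep_iSup_of_pairwise_disjoint hW.sourceSigma_le hW.indep hd) ?_
  exact fun i => (measurable_transmission_iSup W (by simp) (by simp) (by simp)).comap_le

lemma indepFun_gain (hW : W.IsBenchmarkRandom p P) (j : κ) (i : Fin p.N) :
    IndepFun (W.gain i j) (fun ω => (W.transmission j i ω).2) P := by
  have hd : Disjoint ({.gain i j} : Set (Source κ p.N)) {.iot i, .inc i} := by simp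
  have hle : W.sourceSigma (.gain i j) ≤
      ⨆ s ∈ ({.gain i j} : Set (Source κ p.N)), W.sourceSigma s := le_iSup₂_of_le _ rfl le_rfl
  refine indep_of_indep_of_le (indep_iSup_of_disjoint hW.sourceSigma_le hW.indep hd) hle ?_
  have a2 : W.sourceSigma (.iot i) ≤
      ⨆ s ∈ ({.iot i, .inc i} : Set (Source κ p.N)), W.sourceSigma s :=
    le_iSup₂_of_le _ (by simp) le_rfl
  have a3 : W.sourceSigma (.inc i) ≤
      ⨆ s ∈ ({.iot i, .inc i} : Set (Source κ p.N)), W.sourceSigma s :=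
    le_iSup₂_of_le (.inc i) (by simp) le_rfl
  exact (((comap_measurable _).mono a2 le_rfl).prodMk
    ((comap_measurable _).mono a3 le_rfl)).comap_le

variable [IsProbabilityMeasure P]

/-- The Laplace transform of noise plus interference, at the argument that is relevant for a base
station located at `z`. -/
lemma lintegral_expNeg_noiseOf (hW : W.IsBenchmarkRandom p P) {nHat : ℝ} (hn : 0 ≤ nHat) (j : κ)
    (i : Fin p.N) {z : Plane} (hz : z ≠ 0) :
    ∫⁻ ω, expNeg (ENNReal.ofReal (p.τ * ‖z‖ ^ p.α) * noiseOf p nHat j z (W.transmission j i ω).2) ∂P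
      = ENNReal.ofReal (p.decodeProb nHat (Real.pi * p.lamB * ‖z‖ ^ 2)) := by
  have hr : 0 < ‖z‖ := norm_pos_iff.2 hz
  have hτ := p.τ_pos
  have hα := p.α_pos
  have hPI := p.PIHat_pos
  set s := p.τ * ‖z‖ ^ p.α with hs
  have hs0 : 0 < s := by positivity
  have e : ∀ ω, expNeg (ENNReal.ofReal s * noiseOf p nHat j z (W.transmission j i ω).2) =
      expNeg (ENNReal.ofReal (s * nHat)) *
        (expNeg (ENNReal.ofReal s * interferenceOf p.α j
            (z, thinned (W.iot i) (W.iotActive i) (W.iotFading i) ω)) *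
          expNeg (ENNReal.ofReal (s * p.PIHat) * interferenceOf p.α j
            (z, thinned (W.inc i) (W.incActive i) (W.incFading i) ω))) := by
    intro ω
    rw [noiseOf, mul_add, mul_add, expNeg_add, expNeg_add, mul_assoc, ← mul_assoc (ENNReal.ofReal s),
      ENNReal.ofReal_mul hs0.le, ENNReal.ofReal_mul hs0.le]
    rfl
  simp_rw [e]
  have hg : ∀ c : ℝ≥0∞, Measurable fun μ : Measure (Plane × (κ → ℝ)) =>
      expNeg (c * interferenceOf p.α j (z, μ)) := fun c => by fun_prop
  have hm1 := (hW.iot i).measurable_thinned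
  have hm2 := (hW.inc i).measurable_thinned
  have hprod := lintegral_mul_eq_lintegral_mul_lintegral_of_indepFun''
    ((hg (ENNReal.ofReal s)).comp hm1).aemeasurable
    ((hg (ENNReal.ofReal (s * p.PIHat))).comp hm2).aemeasurable
    ((hW.indepFun_thinned i).comp (hg _) (hg _))
  simp only [Function.comp_apply] at hprod
  rw [lintegral_const_mul' _ _ ((expNeg_le_one _).trans_lt ENNReal.one_lt_top).ne, hprod]
  have h1 : ∫⁻ ω, expNeg (ENNReal.ofReal s * interferenceOf p.α j
        (z, thinned (W.iot i) (W.iotActive i) (W.iotFading i) ω)) ∂P =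
      ∫⁻ ω, expNeg (ENNReal.ofReal s *
        interference p.α (W.iot i) (W.iotActive i) (W.iotFading i) j z ω) ∂P := by
    refine lintegral_congr_ae ?_
    filter_upwards [(hW.iot i).ae_interferenceOf_thinned p.α] with ω hω
    rw [hω]
  have h2 : ∫⁻ ω, expNeg (ENNReal.ofReal (s * p.PIHat) * interferenceOf p.α j
        (z, thinned (W.inc i) (W.incActive i) (W.incFading i) ω)) ∂P =
      ∫⁻ ω, expNeg (ENNReal.ofReal (s * p.PIHat) *
        interference p.α (W.inc i) (W.incActive i) (W.incFading i) j z ω) ∂P := by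
    refine lintegral_congr_ae ?_
    filter_upwards [(hW.inc i).ae_interferenceOf_thinned p.α] with ω hω
    rw [hω]
  rw [h1, h2, (hW.iot i).laplace_interference j p.two_lt_α hs0 p.lamIoT_nonneg p.probIoT_nonneg,
    (hW.inc i).laplace_interference j p.two_lt_α (mul_pos hs0 hPI) p.lamI_nonneg p.probI_nonneg,
    expNeg_ofReal (by positivity), ← ENNReal.ofReal_mul (Real.exp_pos _).le, ← Real.exp_add,
    ← ENNReal.ofReal_mul (Real.exp_pos _).le, ← Real.exp_add, Params.decodeProb]
  congr 2
  -- Because `α δ = 2`, the distance enters through `‖z‖ ^ 2`, so the interference exponent is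
  -- proportional to `t`.
  have hδ : s ^ p.δ = p.τ ^ p.δ * ‖z‖ ^ 2 := by
    rw [hs, Real.mul_rpow hτ.le (by positivity), ← Real.rpow_mul hr.le, Params.δ,
      mul_div_cancel₀ _ hα.ne', Real.rpow_two]
  have hpow : (Real.pi * p.lamB * ‖z‖ ^ 2 / (Real.pi * p.lamB)) ^ (p.α / 2) = ‖z‖ ^ p.α := by
    have := p.lamB_pos
    rw [mul_div_cancel_left₀ _ (by positivity), ← Real.rpow_natCast, ← Real.rpow_mul hr.le]
    congr 1
    push_cast
    ring
  rw [← Params.δ, show Real.sin (Real.pi * p.δ) / (p.δ * Real.pi) = p.ξ from rfl,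
    Real.mul_rpow hs0.le hPI.le, hδ, hpow, Params.load, Params.lamIoTTilde_eq, Params.lamITilde_eq,
    ← hs]
  have := p.lamB_pos
  field_simp
  ring

/-- Given noise plus interference `d`, the independent gain exceeds `c d` with probability `exp (-c
d)`; the mean over `d` is a Laplace transform. -/
lemma measure_lt_sinrOf (hW : W.IsBenchmarkRandom p P) {nHat : ℝ} (hn : 0 ≤ nHat) (j : κ)
    (i : Fin p.N) {z : Plane} (hz : z ≠ 0) :
    P {ω | ENNReal.ofReal p.τ < sinrOf p nHat j z (W.transmission j i ω)} =
      ENNReal.ofReal (p.decodeProb nHat (Real.pi * p.lamB * ‖z‖ ^ 2)) := by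
  have := isProbabilityMeasure_expMeasure one_pos
  set c := ENNReal.ofReal (p.τ * ‖z‖ ^ p.α)
  have hD : Measurable fun ω => noiseOf p nHat j z (W.transmission j i ω).2 :=
    (measurable_noiseOf nHat j z).comp (hW.measurable_transmission j i).snd
  have hS : MeasurableSet {q : ℝ × ℝ≥0∞ | c * q.2 < ENNReal.ofReal q.1} :=
    measurableSet_lt (by fun_prop) (by fun_prop)
  have hind : IndepFun (W.gain i j) (fun ω => noiseOf p nHat j z (W.transmission j i ω).2) P :=
    (hW.indepFun_gain j i).comp measurable_id (measurable_noiseOf nHat j z)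
  have e : {ω | ENNReal.ofReal p.τ < sinrOf p nHat j z (W.transmission j i ω)} =
      (fun ω => (W.gain i j ω, noiseOf p nHat j z (W.transmission j i ω).2)) ⁻¹'
        {q : ℝ × ℝ≥0∞ | c * q.2 < ENNReal.ofReal q.1} := by
    ext ω
    exact lt_mul_pathLoss_div_iff p.τ_pos hz _ _
  have := Measure.isProbabilityMeasure_map (μ := P) hD.aemeasurable
  rw [e, ← Measure.map_apply ((hW.measurable_gain i j).prodMk hD) hS,
    (indepFun_iff_map_prod_eq_prod_map_map (hW.measurable_gain i j).aemeasurable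
      hD.aemeasurable).1 hind, hW.law_gain, Measure.prod_apply_symm hS,
    ← hW.lintegral_expNeg_noiseOf hn j i hz,
    ← lintegral_map (f := fun d => expNeg (c * d)) (by fun_prop) hD]
  refine lintegral_congr fun d => ?_
  rw [← expMeasure_one_ofReal_gt]
  rfl

lemma measure_forall_not_lt_sinrOf (hW : W.IsBenchmarkRandom p P) {nHat : ℝ} (hn : 0 ≤ nHat)
    (j : κ) {z : Plane} (hz : z ≠ 0) :
    P {ω | ∀ i, ¬ ENNReal.ofReal p.τ < sinrOf p nHat j z (W.transmission j i ω)} =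
      ENNReal.ofReal ((1 - p.decodeProb nHat (Real.pi * p.lamB * ‖z‖ ^ 2)) ^ p.N) := by
  set B : Set (ℝ × Measure (Plane × (κ → ℝ)) × Measure (Plane × (κ → ℝ))) :=
    {y | ENNReal.ofReal p.τ < sinrOf p nHat j z y}
  have hB : MeasurableSet B :=
    measurableSet_lt measurable_const ((measurable_sinrOf nHat j).comp measurable_prodMk_left)
  have h := (hW.iIndepFun_transmission j).measure_inter_preimage_eq_mul Finset.univ
    (sets := fun _ => Bᶜ) (fun _ _ => hB.compl)
  have e : {ω | ∀ i, ¬ ENNReal.ofReal p.τ < sinrOf p nHat j z (W.transmission j i ω)} =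
      ⋂ i ∈ Finset.univ, W.transmission j i ⁻¹' Bᶜ := by
    ext ω
    simp [B]
  have hlamB := p.lamB_pos
  have hle : p.decodeProb nHat (Real.pi * p.lamB * ‖z‖ ^ 2) ≤ 1 :=
    p.decodeProb_le_one hn (by positivity)
  have h1 : ∀ i, P (W.transmission j i ⁻¹' Bᶜ) =
      ENNReal.ofReal (1 - p.decodeProb nHat (Real.pi * p.lamB * ‖z‖ ^ 2)) := by
    intro i
    rw [Set.preimage_compl, prob_compl_eq_one_sub (hW.measurable_transmission j i hB),
      ENNReal.ofReal_sub _ (p.decodeProb_nonneg _ _), ENNReal.ofReal_one]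
    exact congrArg _ (hW.measure_lt_sinrOf hn j i hz)
  rw [e, h]
  simp_rw [h1]
  rw [Finset.prod_const, Finset.card_univ, Fintype.card_fin, ENNReal.ofReal_pow (by linarith)]

end IsBenchmarkRandom

end Network

/-! ### Integration over the nearest distance and the limit of vanishing noise. -/

lemma integrable_exp_neg_mul_expMeasure {a : ℝ} (ha : 0 ≤ a) :
    Integrable (fun t => Real.exp (-(a * t))) (expMeasure 1) := by
  have := isProbabilityMeasure_expMeasure one_pos
  refine Integrable.of_bound (by fun_prop) 1 ?_
  filter_upwards [ae_expMeasure_one_pos] with t ht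
  rw [Real.norm_eq_abs, Real.abs_exp]
  exact Real.exp_le_one_iff.2 (neg_nonpos.2 (by positivity))

lemma integral_exp_neg_mul_expMeasure {a : ℝ} (ha : 0 ≤ a) :
    ∫ t, Real.exp (-(a * t)) ∂(expMeasure 1) = (1 + a)⁻¹ := by
  rw [integral_eq_lintegral_of_nonneg_ae (ae_of_all _ fun t => (Real.exp_pos _).le) (by fun_prop)]
  have h := lintegral_expNeg_expMeasure (ENNReal.ofReal a)
  rw [← ENNReal.ofReal_one, ← ENNReal.ofReal_add zero_le_one ha,
    ← ENNReal.ofReal_inv_of_pos (by positivity)] at h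
  rw [← ENNReal.toReal_ofReal (r := (1 + a)⁻¹) (by positivity), ← h]
  congr 1
  refine lintegral_congr_ae ?_
  filter_upwards [ae_expMeasure_one_pos] with t ht
  rw [← ENNReal.ofReal_mul ha, expNeg_ofReal (by positivity)]

lemma integral_one_sub_exp_pow_expMeasure {c : ℝ} (hc : 0 ≤ c) (N : ℕ) :
    ∫ t, (1 - Real.exp (-(c * t))) ^ N ∂(expMeasure 1) =
      ∑ k ∈ Finset.range (N + 1), (N.choose k : ℝ) * (-1) ^ k * (1 + k * c)⁻¹ := by
  have e : ∀ t : ℝ, (1 - Real.exp (-(c * t))) ^ N =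
      ∑ k ∈ Finset.range (N + 1), (N.choose k : ℝ) * (-1) ^ k * Real.exp (-(k * c * t)) := by
    intro t
    rw [sub_eq_add_neg, add_comm, add_pow]
    refine Finset.sum_congr rfl fun k _ => ?_
    rw [neg_pow, ← Real.exp_nat_mul, one_pow]
    ring_nf
  simp_rw [e]
  rw [integral_finsetSum]
  · refine Finset.sum_congr rfl fun k _ => ?_
    rw [integral_const_mul, integral_exp_neg_mul_expMeasure (by positivity)]
  · exact fun k _ => (integrable_exp_neg_mul_expMeasure (by positivity)).const_mul _

/-- A given point does not belong to a homogeneous Poisson point process. -/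
lemma IsHPPP.ae_ne {Ω κ : Type*} [MeasurableSpace Ω] {P : Measure Ω} [IsProbabilityMeasure P]
    [Countable κ] {X : κ → Ω → Plane} {lam : ℝ} (h : IsHPPP P X lam) (z : Plane) :
    ∀ᵐ ω ∂P, ∀ j, X j ω ≠ z := by
  have h0 := h.poisson_count {z} (measurableSet_singleton z) Bornology.isBounded_singleton 0
  rw [poissonMeasure_singleton] at h0
  simp only [measure_singleton, ENNReal.toReal_zero, mul_zero, Real.toNNReal_zero, NNReal.coe_zero,
    neg_zero, Real.exp_zero, pow_zero, Nat.factorial_zero, Nat.cast_one, div_one, mul_one,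
    ENNReal.ofReal_one] at h0
  have hm : MeasurableSet {ω | pointCount X {z} ω = ((0 : ℕ) : ℕ∞)} :=
    h.measurable_pointCount (measurableSet_singleton z) (measurableSet_singleton _)
  filter_upwards [(mem_ae_iff_prob_eq_one hm).2 h0] with ω hω j hj
  have : {u | X u ω ∈ ({z} : Set Plane)} = ∅ := by
    simpa [pointCount] using hω
  exact Set.eq_empty_iff_forall_notMem.1 this j hj

namespace Network

variable {Ω κ ι ι' : Type*} [MeasurableSpace Ω] {p : Params} {W : Network Ω κ ι ι' p.N}
  [Countable ι] [Countable ι'] {P : Measure Ω}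

/-- The event that `j` is the nearest base station and decodes none of the transmissions. -/
def nearestFailure (p : Params) (W : Network Ω κ ι ι' p.N) (nHat : ℝ) (j : κ) : Set Ω :=
  {ω | (fun k => W.bs k ω) ∈ uniqueNearest j ∧
    ∀ i, ¬ ENNReal.ofReal p.τ < sinrOf p nHat j (W.bs j ω) (W.transmission j i ω)}

namespace IsBenchmarkRandom

lemma measurable_config (hW : W.IsBenchmarkRandom p P) (j : κ) :
    Measurable fun ω => ((fun k => W.bs k ω), fun i => W.transmission j i ω) :=
  (measurable_pi_lambda _ hW.stations.measurable_point).prodMk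
    (measurable_pi_lambda _ (hW.measurable_transmission j))

variable [Countable κ]

lemma measurableSet_failing_config (nHat : ℝ) (j : κ) :
    MeasurableSet {q : (κ → Plane) × (Fin p.N → ℝ × Measure (Plane × (κ → ℝ)) ×
      Measure (Plane × (κ → ℝ))) | q.1 ∈ uniqueNearest j ∧
        ∀ i, ¬ ENNReal.ofReal p.τ < sinrOf p nHat j (q.1 j) (q.2 i)} := by
  refine (measurable_fst (measurableSet_uniqueNearest j)).inter ?_
  have e : {q : (κ → Plane) × (Fin p.N → ℝ × Measure (Plane × (κ → ℝ)) ×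
      Measure (Plane × (κ → ℝ))) |
        ∀ i, ¬ ENNReal.ofReal p.τ < sinrOf p nHat j (q.1 j) (q.2 i)} =
      ⋂ i, {q | ENNReal.ofReal p.τ < sinrOf p nHat j (q.1 j) (q.2 i)}ᶜ := by
    ext q; simp
  change MeasurableSet {q : (κ → Plane) × (Fin p.N → ℝ × Measure (Plane × (κ → ℝ)) ×
      Measure (Plane × (κ → ℝ))) |
        ∀ i, ¬ ENNReal.ofReal p.τ < sinrOf p nHat j (q.1 j) (q.2 i)}
  rw [e]
  refine MeasurableSet.iInter fun i => MeasurableSet.compl ?_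
  refine measurableSet_lt measurable_const ?_
  have hm : Measurable fun q : (κ → Plane) × (Fin p.N → ℝ × Measure (Plane × (κ → ℝ)) ×
      Measure (Plane × (κ → ℝ))) => (q.1 j, q.2 i) := by fun_prop
  exact (measurable_sinrOf nHat j).comp hm

lemma measurableSet_nearestFailure (hW : W.IsBenchmarkRandom p P) (nHat : ℝ) (j : κ) :
    MeasurableSet (nearestFailure p W nHat j) :=
  hW.measurable_config j (measurableSet_failing_config nHat j)

variable [IsProbabilityMeasure P]

/-- Stations and transmissions are independent, so their joint law is a product and the station
location can be frozen at `x j`, almost surely not the origin. -/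
lemma measure_nearestFailure (hW : W.IsBenchmarkRandom p P) {nHat : ℝ} (hn : 0 ≤ nHat) (j : κ) :
    P (nearestFailure p W nHat j) =
      ∫⁻ ω in (fun ω k => W.bs k ω) ⁻¹' uniqueNearest j,
        ENNReal.ofReal ((1 - p.decodeProb nHat (Real.pi * p.lamB * ‖W.bs j ω‖ ^ 2)) ^ p.N) ∂P := by
  have hX : Measurable fun ω k => W.bs k ω :=
    measurable_pi_lambda _ hW.stations.measurable_point
  have hY : Measurable fun ω i => W.transmission j i ω :=
    measurable_pi_lambda _ (hW.measurable_transmission j)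
  have hS := measurableSet_failing_config (κ := κ) (p := p) nHat j
  have hU := measurableSet_uniqueNearest (κ := κ) j
  have := Measure.isProbabilityMeasure_map (μ := P) hX.aemeasurable
  have := Measure.isProbabilityMeasure_map (μ := P) hY.aemeasurable
  have e : nearestFailure p W nHat j =
      (fun ω => ((fun k => W.bs k ω), fun i => W.transmission j i ω)) ⁻¹'
        {q | q.1 ∈ uniqueNearest j ∧
          ∀ i, ¬ ENNReal.ofReal p.τ < sinrOf p nHat j (q.1 j) (q.2 i)} := rfl
  have hG : Measurable fun x : κ → Plane => (uniqueNearest j).indicator (fun x =>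
      ENNReal.ofReal ((1 - p.decodeProb nHat (Real.pi * p.lamB * ‖x j‖ ^ 2)) ^ p.N)) x :=
    Measurable.indicator (by fun_prop) hU
  rw [e, ← Measure.map_apply (hX.prodMk hY) hS,
    (indepFun_iff_map_prod_eq_prod_map_map hX.aemeasurable hY.aemeasurable).1
      (hW.indepFun_stations j), Measure.prod_apply hS, ← lintegral_indicator (hX hU)]
  have hne : ∀ᵐ x ∂(P.map fun ω k => W.bs k ω), x j ≠ 0 := by
    refine (ae_map_iff hX.aemeasurable ?_).2 ?_
    · have hj : Measurable fun x : κ → Plane => x j := measurable_pi_apply j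
      exact hj (measurableSet_singleton (0 : Plane)).compl
    · filter_upwards [hW.stations.ae_ne 0] with ω hω using hω j
  have key : ∀ᵐ x ∂(P.map fun ω k => W.bs k ω), (P.map fun ω i => W.transmission j i ω)
      (Prod.mk x ⁻¹' {q | q.1 ∈ uniqueNearest j ∧
          ∀ i, ¬ ENNReal.ofReal p.τ < sinrOf p nHat j (q.1 j) (q.2 i)}) =
      (uniqueNearest j).indicator (fun x =>
        ENNReal.ofReal ((1 - p.decodeProb nHat (Real.pi * p.lamB * ‖x j‖ ^ 2)) ^ p.N)) x := by
    filter_upwards [hne] with x hx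
    rw [Measure.map_apply hY (measurable_prodMk_left hS)]
    by_cases hxU : x ∈ uniqueNearest j
    · rw [Set.indicator_of_mem hxU, ← hW.measure_forall_not_lt_sinrOf hn j hx]
      congr 1
      ext ω
      simp [hxU]
    · rw [Set.indicator_of_notMem hxU]
      convert! measure_empty (μ := P)
      ext ω
      simp [hxU]
  rw [lintegral_congr_ae key, lintegral_map hG hX]
  rfl

/-- The success probability, as an integral over the mean number of base stations that are closer
to the origin than the nearest one. -/
lemma measureReal_nearestSuccess (hW : W.IsBenchmarkRandom p P) {nHat : ℝ} (hn : 0 ≤ nHat) :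
    P.real (W.nearestSuccess p nHat) =
      1 - ∫ t, (1 - p.decodeProb nHat t) ^ p.N ∂(expMeasure 1) := by
  have hm : MeasurableSet (⋃ j, nearestFailure p W nHat j) :=
    MeasurableSet.iUnion (hW.measurableSet_nearestFailure nHat)
  -- Away from ties, and where the interference is given by the thinned measures, success is the
  -- complement of a disjoint union of measurable failure events.
  have hae : W.nearestSuccess p nHat =ᵐ[P] ((⋃ j, nearestFailure p W nHat j)ᶜ : Set Ω) := by
    filter_upwards [hW.stations.ae_nearest p.lamB_pos,
      ae_all_iff.2 fun i => (hW.iot i).ae_interferenceOf_thinned p.α,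
      ae_all_iff.2 fun i => (hW.inc i).ae_interferenceOf_thinned p.α] with ω ⟨j, hj, hj'⟩ h1 h2
    have hsinr : ∀ i k, W.sinr p nHat i k ω =
        sinrOf p nHat k (W.bs k ω) (W.transmission k i ω) := by
      intro i k
      simp only [sinr, sinrOf, noiseOf, transmission, h1, h2]
    have hs : ω ∈ W.nearestSuccess p nHat ↔ ∃ i, ENNReal.ofReal p.τ < W.sinr p nHat i j ω := by
      simp [nearestSuccess, hj']
    have hf : ω ∈ (⋃ j, nearestFailure p W nHat j) ↔
        ∀ i, ¬ ENNReal.ofReal p.τ < W.sinr p nHat i j ω := by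
      simp only [Set.mem_iUnion, hsinr]
      refine ⟨fun ⟨k, hk⟩ => ?_, fun h => ⟨j, hj, h⟩⟩
      have hkj : k = j := by
        by_contra hkj
        exact lt_asymm (hj k hkj) (hk.1 j (Ne.symm hkj))
      exact hkj ▸ hk.2
    refine propext ?_
    change ω ∈ W.nearestSuccess p nHat ↔ ω ∉ (⋃ j, nearestFailure p W nHat j)
    rw [hs, hf]
    push Not
    rfl
  rw [measureReal_congr hae, probReal_compl_eq_one_sub hm, measureReal_def, measure_iUnion]
  · simp_rw [hW.measure_nearestFailure hn]
    rw [hW.stations.lintegral_nearest p.lamB_pos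
      (G := fun t => ENNReal.ofReal ((1 - p.decodeProb nHat t) ^ p.N)) (by fun_prop),
      integral_eq_lintegral_of_nonneg_ae _ (by fun_prop)]
    filter_upwards [ae_expMeasure_one_pos] with t ht
    have := p.decodeProb_le_one hn ht.le
    exact pow_nonneg (by linarith) _
  · exact fun j j' hjj' => ((pairwise_disjoint_uniqueNearest hjj').preimage
      (fun ω k => W.bs k ω)).mono (fun _ h => h.1) (fun _ h => h.1)
  · exact hW.measurableSet_nearestFailure nHat

end IsBenchmarkRandom

end Network

lemma Params.nearestClosedForm_eq (p : Params) :
    p.nearestClosedForm = 1 - ∫ t, (1 - p.decodeProb 0 t) ^ p.N ∂(expMeasure 1) := by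
  simp only [Params.decodeProb, mul_zero, zero_add]
  rw [integral_one_sub_exp_pow_expMeasure p.load_nonneg, Params.nearestClosedForm]
  congr 1
  refine Finset.sum_congr rfl fun k _ => ?_
  rw [Params.load]
  ring_nf

/-- The integrand is continuous in the noise and, for nonnegative noise and positive `t`, lies in
`[0, 1]`; the constant `1` dominates. -/
lemma Params.tendsto_integral_decodeProb (p : Params) :
    Tendsto (fun nHat => ∫ t, (1 - p.decodeProb nHat t) ^ p.N ∂(expMeasure 1)) (𝓝[>] 0)
      (𝓝 (∫ t, (1 - p.decodeProb 0 t) ^ p.N ∂(expMeasure 1))) := by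
  have := isProbabilityMeasure_expMeasure one_pos
  refine tendsto_integral_filter_of_dominated_convergence (fun _ => 1)
    (Eventually.of_forall fun _ => by fun_prop) ?_ (integrable_const _) (ae_of_all _ fun t => ?_)
  · filter_upwards [self_mem_nhdsWithin] with nHat hn
    filter_upwards [ae_expMeasure_one_pos] with t ht
    have h0 := p.decodeProb_nonneg nHat t
    have h1 := p.decodeProb_le_one (le_of_lt hn) ht.le
    rw [Real.norm_eq_abs, abs_of_nonneg (pow_nonneg (by linarith) _)]
    exact pow_le_one₀ (by linarith) (by linarith)
  · have : Continuous fun nHat => (1 - p.decodeProb nHat t) ^ p.N := by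
      unfold Params.decodeProb
      fun_prop
    exact (this.tendsto 0).mono_left nhdsWithin_le_nhds

end UNB

/-- Success probability of the benchmark protocol under nearest base station association and random
repetition, in an interference-limited network: without noise, and in the limit of vanishing
noise. -/
theorem theorem2 {Ω κ ι ι' : Type*} [MeasurableSpace Ω] [Countable κ] [Countable ι] [Countable ι']
    (P : Measure Ω) [IsProbabilityMeasure P] (p : UNB.Params) (W : UNB.Network Ω κ ι ι' p.N)
    (hW : W.IsBenchmarkRandom p P) :
    P.real (W.nearestSuccess p 0) = p.nearestClosedForm ∧
      Tendsto (fun nHat : ℝ => P.real (W.nearestSuccess p nHat)) (𝓝[>] 0)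
        (𝓝 p.nearestClosedForm) := by
  rw [p.nearestClosedForm_eq]
  refine ⟨hW.measureReal_nearestSuccess le_rfl,
    (p.tendsto_integral_decodeProb.const_sub 1).congr' ?_⟩
  filter_upwards [self_mem_nhdsWithin] with nHat hn
  exact (hW.measureReal_nearestSuccess (le_of_lt hn)).symm
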